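/- **Model.** The state of nature is $\theta\in\{H,L\}$ with prior $\Pr(\theta=H)=p\in(0,1)$. Signals $s_0,s_1,\dots$ take values in a finite set $S$ and are i.i.d. conditional on $\theta$ with distribution $\pi_\theta$, where $\pi_\theta(s)>0$ for all $s,\theta$ and $\pi_H\neq\pi_L$. A protocol $\Pi=(f,g,a)$ with a set $M$ of $m$ memory states consists of a transition function $f:M\times S\to\Delta(M)$, an initial distribution $g\in\Delta(M)$ and an action rule $a:M\to[0,1]$ ($a(i)$ is the probability of taking action $H$ in memory state $i$). Knowing $\Pi$ and $\theta$ and observing the current memory state, a sender chooses the probability $\sigma(i,\theta)\in[0,1]$ of stopping in each memory state $i$. In period $t$ the game ends if the sender stops or if $m_t$ is absorbing (that is, $f(m_t,s)(m_t)=1$ for all $s\in S$), and action $H$ is then taken with probability $a(m_t)$; otherwise a signal $s_t\sim\pi_\theta$ is generated and $m_{t+1}\sim f(m_t,s_t)$. The sender gets $1$ if the action is $H$ and $0$ otherwise; the receiver gets $1$ if the action equals $\theta$ and $0$ otherwise; both get $0$ if the game never ends. $U^R(\Pi)$ is the receiver's expected payoff when the sender plays a best response to $\Pi$ (the one best for the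 receiver, should best responses differ for him). A protocol is *parsimonious* if it has two absorbing memory states, one with $a=0$ and one with $a=1$, and all other memory states are transient with $a=0$. Let $\mathrm P^\theta$ be the law of the memory states and signals in state of nature $\theta$ when the sender keeps sending signals, and let $\tau^\theta(\Pi)$ be the time of absorption. Label the absorbing state with $a=0$ as $1$, the one with $a=1$ as $m$, and the transient states as $2,\dots,m-1$ so that $\nu_2^H/\nu_2^L\le\dots\le\nu_{m-1}^H/\nu_{m-1}^L$, where $\nu_i^\theta$ is the relative hitting frequency of $i$ (the expected number of visits to $i$ before absorption, divided by the sum of these numbers over all transient states; read $0/0$ as $0$). Let $\bar\ell=\max_s\pi_H(s)/\pi_L(s)$, $\underline\ell=\min_s\pi_H(s)/\pi_L(s)$, $\gamma=\bar\ell/\underline\ell$ and $\kappa=\max\{\frac p{1-p},\frac{1-p}p\}$. Signals with the same likelihood ratio $\pi_H(s)/\pi_L(s)$ are identified in part (i): "$s=h$" means that $s$ has likelihood ratio $\bar\ell$, and "$s=l$" that it has likelihood ratio $\underline\ell$. **Theorem.** Suppose $m\ge4$ and $\gamma^{m-2}>\kappa$, and let $(\Pi^n)_{n\ge1}$, $\Pi^n=(f^n,g^n,a^n)$,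 be parsimonious protocols with $m$ memory states such that $\lim_{n\to\infty}U^R(\Pi^n)=\sup_\Pi U^R(\Pi)$, the supremum being over all protocols with $m$ memory states. Then, as $n\to\infty$: (i) for each $\theta\in\{H,L\}$, $$\mathrm P^\theta\bigl(m_{\tau^\theta(\Pi^n)-1}=2,\ s_{\tau^\theta(\Pi^n)-1}=l\ \big|\ m_{\tau^\theta(\Pi^n)}=1\bigr)\to1,$$ $$\mathrm P^\theta\bigl(m_{\tau^\theta(\Pi^n)-1}=m-1,\ s_{\tau^\theta(\Pi^n)-1}=h\ \big|\ m_{\tau^\theta(\Pi^n)}=m\bigr)\to1;$$ (ii) for all $i\in\{2,\dots,m-1\}$ and $s\in S$, $\ f^n(i,s)(\{1,m\})\to0$. -/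

import Mathlib

open Filter Topology

noncomputable section

/-- The two states of nature (also the names of the receiver's two actions). -/
inductive Nature where
  | H : Nature
  | L : Nature

/-- The exogenous data: the prior probability of `H`, and for each state of nature the distribution
of the i.i.d. signals, which has full support on the finite set `S`; the two distributions differ. -/
structure Environment (S : Type*) [Fintype S] where
  prior : ℝ
  prior_pos : 0 < prior
  prior_lt_one : prior < 1
  sig : Nature → S → ℝ
  sig_pos : ∀ θ s, 0 < sig θ s
  sig_sum : ∀ θ, ∑ s, sig θ s = 1
  sig_ne : sig Nature.H ≠ sig Nature.L

/-- A protocol (finite automaton) with `m` memory states: transition function `f`, initial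
distribution `g`, and action rule `a` (the probability of taking action `H`). -/
structure Protocol (S : Type*) (m : ℕ) where
  f : Fin m → S → Fin m → ℝ
  f_nonneg : ∀ i s j, 0 ≤ f i s j
  f_sum : ∀ i s, ∑ j, f i s j = 1
  g : Fin m → ℝ
  g_nonneg : ∀ i, 0 ≤ g i
  g_sum : ∑ i, g i = 1
  a : Fin m → ℝ
  a_nonneg : ∀ i, 0 ≤ a i
  a_le_one : ∀ i, a i ≤ 1

/-- A (stationary, behavioural) sender strategy: the probability of stopping in each memory state,
for each state of nature. -/
abbrev SenderStrategy (m : ℕ) : Type := Fin m → Nature → unitInterval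

/-- The strategy that never stops the signal process. -/
def keepSending (m : ℕ) : SenderStrategy m := fun _ _ => 0

namespace Environment

variable {S : Type*} [Fintype S] (E : Environment S)

/-- The likelihood ratio of a signal. -/
def ratio (s : S) : ℝ := E.sig Nature.H s / E.sig Nature.L s

/-- The largest likelihood ratio of a signal. -/
def ratioMax : ℝ := ⨆ s, E.ratio s

/-- The smallest likelihood ratio of a signal. -/
def ratioMin : ℝ := ⨅ s, E.ratio s

/-- The informativeness index `γ`. -/
def gamma : ℝ := E.ratioMax / E.ratioMin

/-- The skewness index `κ` of the prior. -/
def kappa : ℝ := max (E.prior / (1 - E.prior)) ((1 - E.prior) / E.prior)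

end Environment

namespace Protocol

variable {S : Type*} {m : ℕ} (Q : Protocol S m)

/-- A memory state that does not update in response to any signal. -/
def IsAbsorbing (i : Fin m) : Prop := ∀ s, Q.f i s i = 1

variable [Fintype S] (E : Environment S)

/-- Transition matrix of the Markov chain on memory states, conditional on the state of nature,
when signals keep arriving. -/
def trans (θ : Nature) : Matrix (Fin m) (Fin m) ℝ :=
  Matrix.of fun i j => ∑ s, E.sig θ s * Q.f i s j

/-- A state is transient if, starting there, the expected number of visits to it is finite. -/
def IsTransient (θ : Nature) (i : Fin m) : Prop :=
  Summable fun t : ℕ => (Q.trans E θ ^ t) i i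

/-- Parsimonious protocols: two absorbing states, one with action `L` and one with action `H`; all
other states are transient, with action `L`. -/
def IsParsimonious : Prop :=
  ∃ x y : Fin m, x ≠ y ∧
    Q.IsAbsorbing x ∧ Q.a x = 0 ∧
    Q.IsAbsorbing y ∧ Q.a y = 1 ∧
    ∀ i, i ≠ x → i ≠ y → (∀ θ, Q.IsTransient E θ i) ∧ Q.a i = 0

open Classical in
/-- Probability that the game ends in the current period when it is running and the memory state
is `i`: it ends for sure in an absorbing state, and otherwise when the sender stops. -/
def endProb (σ : SenderStrategy m) (θ : Nature) (i : Fin m) : ℝ :=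
  if Q.IsAbsorbing i then 1 else (σ i θ : ℝ)

/-- `Q.running E σ θ t i` is the probability, conditional on `θ`, that the game has not ended
before period `t` and that the memory state in period `t` is `i`. -/
def running (σ : SenderStrategy m) (θ : Nature) : ℕ → Fin m → ℝ
  | 0, i => Q.g i
  | t + 1, j =>
      ∑ i, running σ θ t i * (1 - Q.endProb σ θ i) * Q.trans E θ i j

/-- Probability, conditional on `θ`, that the game ends and action `H` is taken. -/
def probHigh (σ : SenderStrategy m) (θ : Nature) : ℝ :=
  ∑' t : ℕ, ∑ i, Q.running E σ θ t i * Q.endProb σ θ i * Q.a i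

/-- Probability, conditional on `θ`, that the game ends and action `L` is taken. -/
def probLow (σ : SenderStrategy m) (θ : Nature) : ℝ :=
  ∑' t : ℕ, ∑ i, Q.running E σ θ t i * Q.endProb σ θ i * (1 - Q.a i)

/-- The sender's expected payoff (she wants action `H`; a game that never ends pays zero). -/
def senderPayoff (σ : SenderStrategy m) : ℝ :=
  E.prior * Q.probHigh E σ Nature.H + (1 - E.prior) * Q.probHigh E σ Nature.L

/-- The receiver's expected payoff (he wants the action to match the state of nature; a game that
never ends pays zero). -/
def receiverPayoff (σ : SenderStrategy m) : ℝ :=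
  E.prior * Q.probHigh E σ Nature.H + (1 - E.prior) * Q.probLow E σ Nature.L

/-- The sender's best responses to the protocol. -/
def bestResponses : Set (SenderStrategy m) :=
  {σ | ∀ σ', Q.senderPayoff E σ' ≤ Q.senderPayoff E σ}

/-- The receiver's payoff from the protocol when the sender plays a best response (the best one for
the receiver, if the best responses differ in whether the game ends). -/
def receiverValue : ℝ := sSup (Q.receiverPayoff E '' Q.bestResponses E)

/-- Expected number of periods, until the game ends, that are spent in memory state `i` when the
sender keeps sending signals. -/
def visits (θ : Nature) (i : Fin m) : ℝ := ∑' t : ℕ, Q.running E (keepSending m) θ t i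

open Classical in
/-- Relative hitting frequency of a transient memory state before absorption. -/
def hitFreq (θ : Nature) (i : Fin m) : ℝ :=
  Q.visits E θ i / ∑ j with Q.IsTransient E θ j, Q.visits E θ j

/-- For an absorbing state `j`, the probability that the chain is absorbed in `j` when the sender
keeps sending signals. Let `τ` be the first period in which the memory state is absorbing. The
`t`-th term is the probability that `τ = t` and the state in period `t` is `j`, since the game ends
on arrival; the term `t = 0` is the case of starting in `j`. -/
def absorbProb (θ : Nature) (j : Fin m) : ℝ := ∑' t : ℕ, Q.running E (keepSending m) θ t j

/-- For an absorbing state `j`, the probability that absorption takes place in `j`, directly from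
memory state `i` and upon signal `s`. With `τ` as above, the `t`-th term is the probability that
`τ = t + 1`, the state and the signal in period `t` are `i` and `s`, and the state in period
`t + 1` is `j`. -/
def absorbFromProb (θ : Nature) (i : Fin m) (s : S) (j : Fin m) : ℝ :=
  ∑' t : ℕ, Q.running E (keepSending m) θ t i * (1 - Q.endProb (keepSending m) θ i)
    * E.sig θ s * Q.f i s j

open Classical in
/-- Conditional on absorption in `j`, the probability that the last memory state before absorption
is `i` and the last signal belongs to `A`. -/
def condLastStep (θ : Nature) (i : Fin m) (A : Set S) (j : Fin m) : ℝ :=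
  (∑ s with s ∈ A, Q.absorbFromProb E θ i s j) / Q.absorbProb E θ j

/-- `lab` labels the memory states by `1, …, m`: the absorbing state with action `L` is `1`, the one
with action `H` is `m`, and the others are `2, …, m - 1` in (weakly) increasing order of the ratio
of their relative hitting frequencies under `H` and `L`. -/
def IsLabeling (lab : ℕ → Fin m) : Prop :=
  Set.BijOn lab (Set.Icc 1 m) Set.univ ∧
    Q.IsAbsorbing (lab 1) ∧ Q.a (lab 1) = 0 ∧
    Q.IsAbsorbing (lab m) ∧ Q.a (lab m) = 1 ∧
    ∀ i j, 2 ≤ i → i ≤ j → j < m →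
      Q.hitFreq E Nature.H (lab i) / Q.hitFreq E Nature.L (lab i) ≤
        Q.hitFreq E Nature.H (lab j) / Q.hitFreq E Nature.L (lab j)

end Protocol

end

/-! Only absorption in `m` pays the sender, so she keeps sending. With `a` and `b` the probabilities
of absorption in `m` under H and L, the receiver gets `p a + (1 - p) (1 - b)`. Everything rests on
the bound `a (1 - b) ≤ γ ^ (m - 2) b (1 - a)` (`odds_le`) and on what near-equality in it forces.

The bound. Let `r_i` be the ratio of the expected visits to the inner state `i` under H and under L.
If the chain restarts from its initial distribution after each absorption, the expected visits form
an invariant measure in both states of nature, so the flows across any cut balance. Across the cut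
between labels `k` and `k + 1`, the upward flow has H/L ratio at most `r_k` times the largest signal
ratio, and the downward flow at least `r_(k+1)` times the smallest one. Hence `r_(k+1) ≤ γ r_k`
(`visitRatio_succ_le`). The likelihood ratio of absorption in `m` is at most `r_(m-1)` times the
largest signal ratio, that of absorption in `1` at least `r_2` times the smallest. The `m - 3` steps
from `r_2` to `r_(m-1)` and the two ends together give the exponent `m - 2`.

Sharpness. Ladder protocols with vanishing exit probabilities approach any pair of error
probabilities in `(0, 1)` that satisfies the bound with equality (`le_iSup_receiverValue`). As `γ ^
(m - 2) > κ`, the best such pair is interior, and asymptotically optimal `a`, `b` converge to it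
(`tendsto_of_asymptotically_optimal`). So the spread of the odds relative to its maximum, `Θ n`,
tends to 1, and all the inequalities above are nearly equalities (`near_equalities`).

Part (i). The likelihood ratio of absorption in `m` averages those of the possible last steps (and 1
for the initial draw). It nearly attains its upper bound, while everything but state `m - 1` with
signal `h` stays a fixed factor below it, hence has vanishing mass (`last_step_concentration`). The
other end is symmetric.

Part (ii). By (i), a restart after absorption in `1` follows the signal `l`. If it lands above a
cut, it is an upward crossing with the wrong signal and causes a definite loss in the cut
inequality. The same holds for restarts below the cut after absorption in `m`. Starts fall on one
side or the other, so each cut suffers a loss bounded away from zero. Near-equality makes the loss a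
vanishing share of the flow, so the flow across each cut diverges. At least half of it leaves from
the state next to the cut, in either direction (`le_innerVisits_of_cut`). Since `m ≥ 4`, each inner
state is next to a cut, so its visits diverge. At most one exit is expected in all, so exit
probabilities vanish. -/

noncomputable section

/-! ### Running probabilities, transience and conservation of mass -/

namespace Protocol

variable {S : Type*} {m : ℕ}

section NoSignals

variable (Q : Protocol S m)

theorem endProb_nonneg (σ : SenderStrategy m) (θ : Nature) (i : Fin m) :
    0 ≤ Q.endProb σ θ i := by
  unfold endProb
  split_ifs
  · exact zero_le_one
  · exact (σ i θ).2.1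

theorem endProb_le_one (σ : SenderStrategy m) (θ : Nature) (i : Fin m) :
    Q.endProb σ θ i ≤ 1 := by
  unfold endProb
  split_ifs
  · exact le_rfl
  · exact (σ i θ).2.2

theorem endProb_keepSending_le (σ : SenderStrategy m) (θ : Nature) (i : Fin m) :
    Q.endProb (keepSending m) θ i ≤ Q.endProb σ θ i := by
  unfold endProb
  split_ifs
  · exact le_rfl
  · simpa [keepSending] using (σ i θ).2.1

end NoSignals

section Basic

variable [Fintype S] (E : Environment S) (Q : Protocol S m)

theorem trans_apply (θ : Nature) (i j : Fin m) :
    Q.trans E θ i j = ∑ s, E.sig θ s * Q.f i s j := rfl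

theorem trans_nonneg (θ : Nature) (i j : Fin m) : 0 ≤ Q.trans E θ i j :=
  Finset.sum_nonneg fun s _ => mul_nonneg (E.sig_pos θ s).le (Q.f_nonneg i s j)

theorem trans_sum (θ : Nature) (i : Fin m) : ∑ j, Q.trans E θ i j = 1 := by
  simp only [trans_apply]
  rw [Finset.sum_comm]
  simp [← Finset.mul_sum, Q.f_sum, E.sig_sum]

theorem running_succ (σ : SenderStrategy m) (θ : Nature) (t : ℕ) (j : Fin m) :
    Q.running E σ θ (t + 1) j =
      ∑ i, Q.running E σ θ t i * (1 - Q.endProb σ θ i) * Q.trans E θ i j := rfl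

theorem running_nonneg (σ : SenderStrategy m) (θ : Nature) (t : ℕ) (i : Fin m) :
    0 ≤ Q.running E σ θ t i := by
  induction t generalizing i with
  | zero => exact Q.g_nonneg i
  | succ t ih =>
    exact Finset.sum_nonneg fun j _ => mul_nonneg
      (mul_nonneg (ih j) (sub_nonneg.2 (Q.endProb_le_one σ θ j))) (Q.trans_nonneg E θ j i)

theorem running_le_keepSending (σ : SenderStrategy m) (θ : Nature) (t : ℕ) (i : Fin m) :
    Q.running E σ θ t i ≤ Q.running E (keepSending m) θ t i := by
  induction t generalizing i with
  | zero => exact le_rfl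
  | succ t ih =>
    refine Finset.sum_le_sum fun j _ => mul_le_mul_of_nonneg_right ?_ (Q.trans_nonneg E θ j i)
    exact mul_le_mul (ih j) (sub_le_sub_left (Q.endProb_keepSending_le σ θ j) 1)
      (sub_nonneg.2 (Q.endProb_le_one σ θ j)) (Q.running_nonneg E _ θ t j)

/-- Ignoring that the game may have ended only adds mass. This links the matrix powers that define
transience to the game. -/
theorem running_le_pow (σ : SenderStrategy m) (θ : Nature) (t : ℕ) (j : Fin m) :
    Q.running E σ θ t j ≤ ∑ i, Q.g i * (Q.trans E θ ^ t) i j := by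
  induction t generalizing j with
  | zero => simp [running, Matrix.one_apply]
  | succ t ih =>
    have h : ∑ i, Q.g i * (Q.trans E θ ^ (t + 1)) i j =
        ∑ k, (∑ i, Q.g i * (Q.trans E θ ^ t) i k) * Q.trans E θ k j := by
      simp only [pow_succ, Matrix.mul_apply, Finset.mul_sum, Finset.sum_mul, mul_assoc]
      exact Finset.sum_comm
    rw [h, running_succ]
    refine Finset.sum_le_sum fun k _ => mul_le_mul_of_nonneg_right ?_ (Q.trans_nonneg E θ k j)
    refine le_trans ?_ (ih k)
    exact mul_le_of_le_one_right (Q.running_nonneg E σ θ t k)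
      (sub_le_self _ (Q.endProb_nonneg σ θ k))

theorem pow_nonneg (θ : Nature) (t : ℕ) (i j : Fin m) : 0 ≤ (Q.trans E θ ^ t) i j := by
  induction t generalizing j with
  | zero =>
    rw [pow_zero, Matrix.one_apply]
    split_ifs <;> norm_num
  | succ t ih =>
    rw [pow_succ, Matrix.mul_apply]
    exact Finset.sum_nonneg fun k _ => mul_nonneg (ih k) (Q.trans_nonneg E θ k j)

/-- The expected number of visits to `j` up to a given time is largest when starting in `j`. -/
theorem sum_pow_le_diag (θ : Nature) (T : ℕ) (i j : Fin m) :
    ∑ t ∈ Finset.range T, (Q.trans E θ ^ t) i j ≤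
      ∑ t ∈ Finset.range T, (Q.trans E θ ^ t) j j := by
  induction T generalizing i with
  | zero => simp
  | succ T ih =>
    by_cases hij : i = j
    · rw [hij]
    have h1 : ∑ t ∈ Finset.range (T + 1), (Q.trans E θ ^ t) i j =
        ∑ k, Q.trans E θ i k * ∑ t ∈ Finset.range T, (Q.trans E θ ^ t) k j := by
      rw [Finset.sum_range_succ']
      simp only [pow_succ', Matrix.mul_apply, pow_zero, Matrix.one_apply, hij, if_false, add_zero,
        Finset.mul_sum]
      exact Finset.sum_comm
    rw [h1]
    calc ∑ k, Q.trans E θ i k * ∑ t ∈ Finset.range T, (Q.trans E θ ^ t) k j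
        ≤ ∑ k, Q.trans E θ i k * ∑ t ∈ Finset.range T, (Q.trans E θ ^ t) j j :=
          Finset.sum_le_sum fun k _ => mul_le_mul_of_nonneg_left (ih k) (Q.trans_nonneg E θ i k)
      _ = ∑ t ∈ Finset.range T, (Q.trans E θ ^ t) j j := by
          rw [← Finset.sum_mul, Q.trans_sum, one_mul]
      _ ≤ _ := by
          rw [Finset.sum_range_succ]
          exact le_add_of_nonneg_right (Q.pow_nonneg E θ T j j)

variable {E Q} in
theorem IsTransient.summable_running {θ : Nature} {j : Fin m} (h : Q.IsTransient E θ j)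
    (σ : SenderStrategy m) : Summable fun t => Q.running E σ θ t j := by
  have h2 : ∀ i, Summable fun t : ℕ => (Q.trans E θ ^ t) i j := fun i =>
    summable_of_sum_range_le (fun t => Q.pow_nonneg E θ t i j) fun T =>
      (Q.sum_pow_le_diag E θ T i j).trans (h.sum_le_tsum _ fun t _ => Q.pow_nonneg E θ t j j)
  exact Summable.of_nonneg_of_le (fun t => Q.running_nonneg E σ θ t j)
    (fun t => Q.running_le_pow E σ θ t j) (summable_sum fun i _ => (h2 i).mul_left (Q.g i))

theorem sum_running_succ (σ : SenderStrategy m) (θ : Nature) (t : ℕ) :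
    ∑ j, Q.running E σ θ (t + 1) j = ∑ i, Q.running E σ θ t i * (1 - Q.endProb σ θ i) := by
  simp only [running_succ]
  rw [Finset.sum_comm]
  simp [← Finset.mul_sum, Q.trans_sum]

theorem sum_ended_add_running (σ : SenderStrategy m) (θ : Nature) (T : ℕ) :
    ∑ t ∈ Finset.range T, ∑ i, Q.running E σ θ t i * Q.endProb σ θ i +
      ∑ i, Q.running E σ θ T i = 1 := by
  induction T with
  | zero => simpa [running] using Q.g_sum
  | succ T ih =>
    rw [Finset.sum_range_succ, sum_running_succ, add_assoc, ← Finset.sum_add_distrib]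
    refine Eq.trans ?_ ih
    congr 1
    exact Finset.sum_congr rfl fun i _ => by ring

theorem ended_nonneg (σ : SenderStrategy m) (θ : Nature) (t : ℕ) (i : Fin m) :
    0 ≤ Q.running E σ θ t i * Q.endProb σ θ i :=
  mul_nonneg (Q.running_nonneg E σ θ t i) (Q.endProb_nonneg σ θ i)

theorem summable_ended (σ : SenderStrategy m) (θ : Nature) :
    Summable fun t => ∑ i, Q.running E σ θ t i * Q.endProb σ θ i :=
  summable_of_sum_range_le (fun t => Finset.sum_nonneg fun i _ => Q.ended_nonneg E σ θ t i)
    (c := 1) fun T => by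
      rw [← Q.sum_ended_add_running E σ θ T]
      exact le_add_of_nonneg_right (Finset.sum_nonneg fun i _ => Q.running_nonneg E σ θ T i)

theorem tsum_ended_le_one (σ : SenderStrategy m) (θ : Nature) :
    ∑' t, ∑ i, Q.running E σ θ t i * Q.endProb σ θ i ≤ 1 :=
  Real.tsum_le_of_sum_range_le
    (fun t => Finset.sum_nonneg fun i _ => Q.ended_nonneg E σ θ t i) fun T => by
      rw [← Q.sum_ended_add_running E σ θ T]
      exact le_add_of_nonneg_right (Finset.sum_nonneg fun i _ => Q.running_nonneg E σ θ T i)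

theorem summable_high (σ : SenderStrategy m) (θ : Nature) :
    Summable fun t => ∑ i, Q.running E σ θ t i * Q.endProb σ θ i * Q.a i :=
  Summable.of_nonneg_of_le
    (fun t => Finset.sum_nonneg fun i _ => mul_nonneg (Q.ended_nonneg E σ θ t i) (Q.a_nonneg i))
    (fun t => Finset.sum_le_sum fun i _ =>
      mul_le_of_le_one_right (Q.ended_nonneg E σ θ t i) (Q.a_le_one i))
    (Q.summable_ended E σ θ)

theorem probHigh_add_probLow (σ : SenderStrategy m) (θ : Nature) :
    Q.probHigh E σ θ + Q.probLow E σ θ =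
      ∑' t, ∑ i, Q.running E σ θ t i * Q.endProb σ θ i := by
  have h : Summable fun t => ∑ i, Q.running E σ θ t i * Q.endProb σ θ i * (1 - Q.a i) := by
    refine ((Q.summable_ended E σ θ).sub (Q.summable_high E σ θ)).congr fun t => ?_
    rw [← Finset.sum_sub_distrib]
    exact Finset.sum_congr rfl fun i _ => by ring
  unfold probHigh probLow
  rw [← (Q.summable_high E σ θ).tsum_add h]
  refine tsum_congr fun t => ?_
  rw [← Finset.sum_add_distrib]
  exact Finset.sum_congr rfl fun i _ => by ring

theorem probHigh_nonneg (σ : SenderStrategy m) (θ : Nature) : 0 ≤ Q.probHigh E σ θ :=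
  tsum_nonneg fun t => Finset.sum_nonneg fun i _ =>
    mul_nonneg (Q.ended_nonneg E σ θ t i) (Q.a_nonneg i)

theorem probLow_nonneg (σ : SenderStrategy m) (θ : Nature) : 0 ≤ Q.probLow E σ θ :=
  tsum_nonneg fun t => Finset.sum_nonneg fun i _ =>
    mul_nonneg (Q.ended_nonneg E σ θ t i) (sub_nonneg.2 (Q.a_le_one i))

theorem probHigh_add_probLow_le_one (σ : SenderStrategy m) (θ : Nature) :
    Q.probHigh E σ θ + Q.probLow E σ θ ≤ 1 :=
  (Q.probHigh_add_probLow E σ θ).trans_le (Q.tsum_ended_le_one E σ θ)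

theorem receiverPayoff_le_one (σ : SenderStrategy m) : Q.receiverPayoff E σ ≤ 1 := by
  unfold receiverPayoff
  have h1 := Q.probHigh_add_probLow_le_one E σ Nature.H
  have h2 := Q.probHigh_add_probLow_le_one E σ Nature.L
  have h3 := Q.probLow_nonneg E σ Nature.H
  have h4 := Q.probHigh_nonneg E σ Nature.L
  nlinarith [E.prior_pos, E.prior_lt_one]

theorem receiverValue_le_one : Q.receiverValue E ≤ 1 := by
  refine Real.sSup_le ?_ zero_le_one
  rintro _ ⟨σ, -, rfl⟩
  exact Q.receiverPayoff_le_one E σ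

theorem bddAbove_receiverValue :
    BddAbove (Set.range fun R : Protocol S m => R.receiverValue E) :=
  ⟨1, by rintro _ ⟨R, rfl⟩; exact R.receiverValue_le_one E⟩

end Basic

/-! ### Expected visits, absorption probabilities and the receiver's value -/

/-- The chain of memory states has exactly the two absorbing states `x` and `y`, and all other
memory states are transient. -/
structure AbsorbsAt [Fintype S] (Q : Protocol S m) (E : Environment S) (x y : Fin m) : Prop where
  ne : x ≠ y
  left : Q.IsAbsorbing x
  right : Q.IsAbsorbing y
  transient : ∀ i, i ≠ x → i ≠ y → ∀ θ, Q.IsTransient E θ i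

/-- Expected number of visits to a memory state that is not absorbing (zero for an absorbing
state) when the sender keeps sending signals. -/
def innerVisits [Fintype S] (Q : Protocol S m) (E : Environment S) (θ : Nature) (i : Fin m) : ℝ :=
  (1 - Q.endProb (keepSending m) θ i) * Q.visits E θ i

variable [Fintype S] {E : Environment S} {Q : Protocol S m} {x y : Fin m}

theorem IsAbsorbing.not_isTransient {i : Fin m} (h : Q.IsAbsorbing i) (θ : Nature) :
    ¬ Q.IsTransient E θ i := by
  intro ht
  have h1 : ∀ t, 1 ≤ (Q.trans E θ ^ t) i i := by
    intro t
    induction t with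
    | zero => simp
    | succ t ih =>
      rw [pow_succ, Matrix.mul_apply]
      have h2 : Q.trans E θ i i = 1 := by simp [trans_apply, h _, E.sig_sum]
      calc (1 : ℝ) ≤ (Q.trans E θ ^ t) i i * Q.trans E θ i i := by rw [h2, mul_one]; exact ih
        _ ≤ _ := Finset.single_le_sum (f := fun k => (Q.trans E θ ^ t) i k * Q.trans E θ k i)
            (fun k _ => mul_nonneg (Q.pow_nonneg E θ t i k) (Q.trans_nonneg E θ k i))
            (Finset.mem_univ i)
  have h3 := ht.tendsto_atTop_zero
  exact absurd (ge_of_tendsto' h3 h1) (by norm_num)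

namespace AbsorbsAt

theorem isAbsorbing_iff (h : Q.AbsorbsAt E x y) (i : Fin m) :
    Q.IsAbsorbing i ↔ i = x ∨ i = y := by
  constructor
  · intro hi
    by_contra hc
    push Not at hc
    exact hi.not_isTransient Nature.H (h.transient i hc.1 hc.2 Nature.H)
  · rintro (rfl | rfl)
    exacts [h.left, h.right]

theorem endProb_left (h : Q.AbsorbsAt E x y) (σ : SenderStrategy m) (θ : Nature) :
    Q.endProb σ θ x = 1 := by
  simp [endProb, h.left]

theorem endProb_right (h : Q.AbsorbsAt E x y) (σ : SenderStrategy m) (θ : Nature) :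
    Q.endProb σ θ y = 1 := by
  simp [endProb, h.right]

theorem endProb_inner (h : Q.AbsorbsAt E x y) (θ : Nature) {i : Fin m} (hx : i ≠ x)
    (hy : i ≠ y) : Q.endProb (keepSending m) θ i = 0 := by
  simp [endProb, h.isAbsorbing_iff, hx, hy, keepSending]

theorem endProb_keepSending (h : Q.AbsorbsAt E x y) (θ : Nature) (i : Fin m) :
    Q.endProb (keepSending m) θ i = (if i = x then 1 else 0) + if i = y then 1 else 0 := by
  by_cases hx : i = x
  · subst hx
    simp [h.endProb_left, h.ne]
  · by_cases hy : i = y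
    · subst hy
      simp [h.endProb_right, hx]
    · simp [h.endProb_inner θ hx hy, hx, hy]

theorem sum_ended (h : Q.AbsorbsAt E x y) (θ : Nature) (t : ℕ) :
    ∑ i, Q.running E (keepSending m) θ t i * Q.endProb (keepSending m) θ i =
      Q.running E (keepSending m) θ t x + Q.running E (keepSending m) θ t y := by
  simp [h.endProb_keepSending, mul_add, Finset.sum_add_distrib]

theorem summable_running (h : Q.AbsorbsAt E x y) (θ : Nature) (i : Fin m) :
    Summable fun t => Q.running E (keepSending m) θ t i := by
  by_cases hi : i ≠ x ∧ i ≠ y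
  · exact (h.transient i hi.1 hi.2 θ).summable_running _
  · refine Summable.of_nonneg_of_le (fun t => Q.running_nonneg E _ θ t i) (fun t => ?_)
      (Q.summable_ended E (keepSending m) θ)
    rw [h.sum_ended]
    have h1 := Q.running_nonneg E (keepSending m) θ t x
    have h2 := Q.running_nonneg E (keepSending m) θ t y
    by_cases hx : i = x
    · subst hx; linarith
    · have hy : i = y := by tauto
      subst hy; linarith

/-- Absorption is certain: visits to every state are summable, so the mass still running tends to
zero. The game ends on arrival in an absorbing state, so there `visits` is a probability. -/
theorem visits_add_visits (h : Q.AbsorbsAt E x y) (θ : Nature) :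
    Q.visits E θ x + Q.visits E θ y = 1 := by
  have h1 : Tendsto (fun T => ∑ i, Q.running E (keepSending m) θ T i) atTop (𝓝 0) := by
    have := tendsto_finsetSum (Finset.univ : Finset (Fin m)) fun i _ =>
      (h.summable_running θ i).tendsto_atTop_zero
    simpa using this
  have h2 := ((h.summable_running θ x).add (h.summable_running θ y)).hasSum.tendsto_sum_nat
  have h3 := h2.add h1
  have h4 : ∀ T, (∑ t ∈ Finset.range T, (Q.running E (keepSending m) θ t x +
      Q.running E (keepSending m) θ t y)) + ∑ i, Q.running E (keepSending m) θ T i = 1 := by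
    intro T
    rw [← Q.sum_ended_add_running E (keepSending m) θ T]
    simp only [h.sum_ended]
  simp only [h4, add_zero] at h3
  have h5 := tendsto_nhds_unique tendsto_const_nhds h3
  rw [(h.summable_running θ x).tsum_add (h.summable_running θ y)] at h5
  exact h5.symm

theorem visits_nonneg (Q : Protocol S m) (E : Environment S) (θ : Nature) (i : Fin m) :
    0 ≤ Q.visits E θ i :=
  tsum_nonneg fun t => Q.running_nonneg E _ θ t i

theorem innerVisits_nonneg (Q : Protocol S m) (E : Environment S) (θ : Nature) (i : Fin m) :
    0 ≤ Q.innerVisits E θ i :=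
  mul_nonneg (sub_nonneg.2 (Q.endProb_le_one _ θ i)) (visits_nonneg Q E θ i)

theorem innerVisits_left (h : Q.AbsorbsAt E x y) (θ : Nature) : Q.innerVisits E θ x = 0 := by
  simp [innerVisits, h.endProb_left]

theorem innerVisits_right (h : Q.AbsorbsAt E x y) (θ : Nature) : Q.innerVisits E θ y = 0 := by
  simp [innerVisits, h.endProb_right]

theorem innerVisits_inner (h : Q.AbsorbsAt E x y) (θ : Nature) {i : Fin m} (hx : i ≠ x)
    (hy : i ≠ y) : Q.innerVisits E θ i = Q.visits E θ i := by
  simp [innerVisits, h.endProb_inner θ hx hy]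

/-- The visits to a state are those at the start and those that come from other states. -/
theorem visits_eq (h : Q.AbsorbsAt E x y) (θ : Nature) (j : Fin m) :
    Q.visits E θ j = Q.g j + ∑ i, Q.innerVisits E θ i * Q.trans E θ i j := by
  unfold visits
  rw [(h.summable_running θ j).tsum_eq_zero_add]
  congr 1
  simp only [running_succ, innerVisits, visits]
  rw [Summable.tsum_finsetSum fun i _ => ((h.summable_running θ i).mul_right _).mul_right _]
  refine Finset.sum_congr rfl fun i _ => ?_
  rw [tsum_mul_right, tsum_mul_right]
  ring

theorem absorbFromProb_eq (_h : Q.AbsorbsAt E x y) (θ : Nature) (i : Fin m) (s : S) (j : Fin m) :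
    Q.absorbFromProb E θ i s j = Q.innerVisits E θ i * E.sig θ s * Q.f i s j := by
  unfold absorbFromProb innerVisits visits
  rw [tsum_mul_right, tsum_mul_right, tsum_mul_right]
  ring

/-- Harmonic functions determine the absorption probabilities. -/
theorem visits_right_eq_of_harmonic (h : Q.AbsorbsAt E x y) (θ : Nature) (u : Fin m → ℝ)
    (hux : u x = 0) (huy : u y = 1)
    (hu : ∀ i, i ≠ x → i ≠ y → ∑ j, Q.trans E θ i j * u j = u i) :
    Q.visits E θ y = ∑ i, Q.g i * u i := by
  have h1 : ∑ j, Q.visits E θ j * u j =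
      ∑ j, Q.g j * u j + ∑ i, Q.innerVisits E θ i * u i := by
    have h2 : ∑ i, Q.innerVisits E θ i * u i =
        ∑ i, Q.innerVisits E θ i * ∑ j, Q.trans E θ i j * u j := by
      refine Finset.sum_congr rfl fun i _ => ?_
      by_cases hx : i = x
      · subst hx; simp [h.innerVisits_left]
      · by_cases hy : i = y
        · subst hy; simp [h.innerVisits_right]
        · rw [hu i hx hy]
    rw [h2, Finset.sum_congr rfl fun j _ => by rw [h.visits_eq θ j]]
    simp only [add_mul, Finset.sum_add_distrib, Finset.sum_mul, Finset.mul_sum, mul_assoc]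
    congr 1
    exact Finset.sum_comm
  have h3 : ∑ j, Q.visits E θ j * u j =
      ∑ i, Q.innerVisits E θ i * u i + Q.visits E θ y := by
    have h4 : ∀ j, Q.visits E θ j * u j = Q.innerVisits E θ j * u j +
        if j = y then Q.visits E θ y else 0 := by
      intro j
      by_cases hx : j = x
      · subst hx; simp [h.innerVisits_left, hux, h.ne]
      · by_cases hy : j = y
        · subst hy; simp [h.innerVisits_right, huy]
        · simp [h.innerVisits_inner θ hx hy, hy]
    simp [h4, Finset.sum_add_distrib]
  linarith

theorem probHigh_eq (h : Q.AbsorbsAt E x y) (hay : Q.a y = 1) (ha : ∀ i, i ≠ y → Q.a i = 0)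
    (σ : SenderStrategy m) (θ : Nature) :
    Q.probHigh E σ θ = ∑' t, Q.running E σ θ t y := by
  unfold probHigh
  refine tsum_congr fun t => ?_
  rw [Finset.sum_eq_single y (fun i _ hi => by simp [ha i hi]) (by simp), h.endProb_right, hay]
  ring

/-- Only `y` carries action H, so stopping elsewhere merely removes paths that might still reach it.
-/
theorem probHigh_le (h : Q.AbsorbsAt E x y) (hay : Q.a y = 1) (ha : ∀ i, i ≠ y → Q.a i = 0)
    (σ : SenderStrategy m) (θ : Nature) :
    Q.probHigh E σ θ ≤ Q.probHigh E (keepSending m) θ := by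
  rw [h.probHigh_eq hay ha, h.probHigh_eq hay ha]
  exact Summable.tsum_le_tsum (fun t => Q.running_le_keepSending E σ θ t y)
    (Summable.of_nonneg_of_le (fun t => Q.running_nonneg E σ θ t y)
      (fun t => Q.running_le_keepSending E σ θ t y) (h.summable_running θ y))
    (h.summable_running θ y)

theorem receiverPayoff_keepSending (h : Q.AbsorbsAt E x y) (hay : Q.a y = 1)
    (ha : ∀ i, i ≠ y → Q.a i = 0) :
    Q.receiverPayoff E (keepSending m) =
      E.prior * Q.visits E Nature.H y + (1 - E.prior) * (1 - Q.visits E Nature.L y) := by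
  have h1 := Q.probHigh_add_probLow E (keepSending m) Nature.L
  simp only [h.sum_ended] at h1
  rw [(h.summable_running _ x).tsum_add (h.summable_running _ y)] at h1
  have h2 := h.visits_add_visits Nature.L
  unfold visits at h2
  rw [h2] at h1
  unfold receiverPayoff
  have h3 : Q.probLow E (keepSending m) Nature.L = 1 - Q.visits E Nature.L y := by
    rw [eq_sub_iff_add_eq', visits, ← h.probHigh_eq hay ha]
    exact h1
  rw [h3, h.probHigh_eq hay ha]
  rfl

/-- Against a parsimonious protocol it is optimal for the sender to keep sending signals, and this
is best for the receiver among the sender's best responses. -/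
theorem receiverValue_eq (h : Q.AbsorbsAt E x y) (hay : Q.a y = 1)
    (ha : ∀ i, i ≠ y → Q.a i = 0) :
    Q.receiverValue E =
      E.prior * Q.visits E Nature.H y + (1 - E.prior) * (1 - Q.visits E Nature.L y) := by
  rw [← h.receiverPayoff_keepSending hay ha]
  have hp := E.prior_pos
  have hp1 := E.prior_lt_one
  have hmem : keepSending m ∈ Q.bestResponses E := by
    intro σ
    unfold senderPayoff
    have h1 := h.probHigh_le hay ha σ Nature.H
    have h2 := h.probHigh_le hay ha σ Nature.L
    nlinarith
  refine IsGreatest.csSup_eq ⟨⟨_, hmem, rfl⟩, ?_⟩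
  rintro _ ⟨σ, hσ, rfl⟩
  have h0 := hσ (keepSending m)
  have h1 := h.probHigh_le hay ha σ Nature.H
  have h2 := h.probHigh_le hay ha σ Nature.L
  have h3 := Q.probHigh_add_probLow_le_one E σ Nature.L
  have h4 := h.receiverPayoff_keepSending hay ha
  unfold receiverPayoff senderPayoff at *
  have h5 : Q.probHigh E (keepSending m) Nature.L = Q.visits E Nature.L y :=
    h.probHigh_eq hay ha _ _
  have h5' : Q.probHigh E (keepSending m) Nature.H = Q.visits E Nature.H y :=
    h.probHigh_eq hay ha _ _
  rw [h5'] at h4 h0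
  have h6 := mul_le_mul_of_nonneg_left h1 hp.le
  rw [h5'] at h6 ⊢
  have h7 := mul_le_mul_of_nonneg_left h2 (sub_pos.2 hp1).le
  -- A best response cannot gain in H, so it cannot lose in L either. Hence it induces H in state L
  -- as often as never stopping does, and the receiver cannot gain from it there.
  have h8 : Q.probHigh E (keepSending m) Nature.L ≤ Q.probHigh E σ Nature.L :=
    le_of_mul_le_mul_left (by linarith) (sub_pos.2 hp1)
  have h9 : Q.probLow E σ Nature.L ≤ 1 - Q.visits E Nature.L y := by linarith
  have h10 := mul_le_mul_of_nonneg_left h9 (sub_pos.2 hp1).le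
  linarith

end AbsorbsAt

end Protocol

/-! ### Likelihood ratios of signals -/

namespace Environment

variable {S : Type*} [Fintype S] (E : Environment S)

theorem nonempty_signals {S : Type*} [Fintype S] (E : Environment S) : Nonempty S := by
  by_contra h
  rw [not_nonempty_iff] at h
  simpa using E.sig_sum Nature.H

theorem ratio_pos (s : S) : 0 < E.ratio s := div_pos (E.sig_pos _ s) (E.sig_pos _ s)

theorem sig_high_eq (s : S) : E.sig Nature.H s = E.ratio s * E.sig Nature.L s :=
  (div_mul_cancel₀ _ (E.sig_pos Nature.L s).ne').symm

theorem ratio_le_ratioMax (s : S) : E.ratio s ≤ E.ratioMax :=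
  le_ciSup (Set.finite_range E.ratio).bddAbove s

theorem ratioMin_le_ratio (s : S) : E.ratioMin ≤ E.ratio s :=
  ciInf_le (Set.finite_range E.ratio).bddBelow s

theorem exists_ratio_eq_ratioMax : ∃ s, E.ratio s = E.ratioMax :=
  have := E.nonempty_signals
  exists_eq_ciSup_of_finite

theorem exists_ratio_eq_ratioMin : ∃ s, E.ratio s = E.ratioMin :=
  have := E.nonempty_signals
  exists_eq_ciInf_of_finite

theorem ratioMin_pos : 0 < E.ratioMin := by
  obtain ⟨s, hs⟩ := E.exists_ratio_eq_ratioMin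
  exact hs ▸ E.ratio_pos s

theorem ratioMin_lt_ratioMax : E.ratioMin < E.ratioMax := by
  by_contra hc
  push Not at hc
  have h1 : ∀ s, E.sig Nature.H s = E.ratioMin * E.sig Nature.L s := by
    intro s
    rw [E.sig_high_eq, le_antisymm ((E.ratio_le_ratioMax s).trans hc) (E.ratioMin_le_ratio s)]
  have h2 := E.sig_sum Nature.H
  simp only [h1, ← Finset.mul_sum, E.sig_sum, mul_one] at h2
  exact E.sig_ne (funext fun s => by rw [h1, h2, one_mul])

theorem ratioMax_pos : 0 < E.ratioMax := E.ratioMin_pos.trans E.ratioMin_lt_ratioMax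

theorem one_lt_gamma : 1 < E.gamma := (one_lt_div E.ratioMin_pos).2 E.ratioMin_lt_ratioMax

theorem gamma_mul_ratioMin : E.gamma * E.ratioMin = E.ratioMax :=
  div_mul_cancel₀ _ E.ratioMin_pos.ne'

/-- The extreme likelihood ratios are separated from the other ones. -/
theorem exists_ratio_gap : ∃ c, 0 < c ∧ c < 1 ∧
    (∀ s, E.ratio s ≠ E.ratioMax → E.ratio s ≤ (1 - c) * E.ratioMax) ∧
    ∀ s, E.ratio s ≠ E.ratioMin → E.ratioMin ≤ (1 - c) * E.ratio s := by
  have h1 : ∀ s, ∀ᶠ c : ℝ in 𝓝[>] 0, (E.ratio s ≠ E.ratioMax →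
      E.ratio s ≤ (1 - c) * E.ratioMax) ∧
      (E.ratio s ≠ E.ratioMin → E.ratioMin ≤ (1 - c) * E.ratio s) := by
    intro s
    refine Filter.Eventually.and ?_ ?_
    · by_cases hs : E.ratio s = E.ratioMax
      · simp [hs]
      have h2 : Tendsto (fun c : ℝ => (1 - c) * E.ratioMax) (𝓝[>] 0) (𝓝 ((1 - 0) * E.ratioMax)) :=
        Tendsto.mono_left (Continuous.tendsto (by fun_prop) 0) nhdsWithin_le_nhds
      have h3 : E.ratio s < (1 - 0) * E.ratioMax := by
        simpa using lt_of_le_of_ne (E.ratio_le_ratioMax s) hs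
      filter_upwards [h2.eventually_const_lt h3] with c hc _ using hc.le
    · by_cases hs : E.ratio s = E.ratioMin
      · simp [hs]
      have h2 : Tendsto (fun c : ℝ => (1 - c) * E.ratio s) (𝓝[>] 0) (𝓝 ((1 - 0) * E.ratio s)) :=
        Tendsto.mono_left (Continuous.tendsto (by fun_prop) 0) nhdsWithin_le_nhds
      have h3 : E.ratioMin < (1 - 0) * E.ratio s := by
        simpa using lt_of_le_of_ne (E.ratioMin_le_ratio s) (Ne.symm hs)
      filter_upwards [h2.eventually_const_lt h3] with c hc _ using hc.le
  have h4 : ∀ᶠ c : ℝ in 𝓝[>] 0, c < 1 :=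
    nhdsWithin_le_nhds (eventually_lt_nhds one_pos)
  obtain ⟨c, ⟨h5, h6⟩, h7⟩ :=
    (((eventually_all.2 h1).and h4).and self_mem_nhdsWithin).exists
  exact ⟨c, h7, h6, fun s => (h5 s).1, fun s => (h5 s).2⟩

end Environment

/-! ### The restarted chain and flows across cuts -/

namespace Protocol

variable {S : Type*} {m : ℕ}

/-- The transition function of the chain that starts anew, at a transient state, upon
absorption in `x` or `y`. -/
def restart (Q : Protocol S m) (x y i : Fin m) (s : S) (j : Fin m) : ℝ :=
  if j = x ∨ j = y then 0
  else Q.f i s j + (Q.f i s x + Q.f i s y) * (Q.g j / (1 - Q.g x - Q.g y))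

variable [Fintype S] {E : Environment S} {Q : Protocol S m} {x y : Fin m}

/-- Expected number of visits to the inner memory state `i` followed by the signal `s`. -/
def weight (Q : Protocol S m) (E : Environment S) (θ : Nature) (i : Fin m) (s : S) : ℝ :=
  Q.innerVisits E θ i * E.sig θ s

/-- Expected flow from `C` to `D` in the chain that starts anew upon absorption. -/
def flow (Q : Protocol S m) (E : Environment S) (x y : Fin m) (θ : Nature)
    (C D : Finset (Fin m)) : ℝ :=
  ∑ i ∈ C, ∑ s, Q.weight E θ i s * ∑ j ∈ D, Q.restart x y i s j

/-- Likelihood ratio of an inner memory state. -/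
def visitRatio (Q : Protocol S m) (E : Environment S) (i : Fin m) : ℝ :=
  Q.innerVisits E Nature.H i / Q.innerVisits E Nature.L i

namespace AbsorbsAt

theorem weight_nonneg (Q : Protocol S m) (E : Environment S) (θ : Nature) (i : Fin m) (s : S) :
    0 ≤ Q.weight E θ i s :=
  mul_nonneg (innerVisits_nonneg Q E θ i) (E.sig_pos θ s).le

theorem sum_weight (Q : Protocol S m) (E : Environment S) (θ : Nature) (i : Fin m) :
    ∑ s, Q.weight E θ i s = Q.innerVisits E θ i := by
  simp [weight, ← Finset.mul_sum, E.sig_sum]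

theorem visits_eq_weight (h : Q.AbsorbsAt E x y) (θ : Nature) (j : Fin m) :
    Q.visits E θ j = Q.g j + ∑ i, ∑ s, Q.weight E θ i s * Q.f i s j := by
  rw [h.visits_eq]
  simp [trans_apply, Finset.mul_sum, weight, mul_assoc]

/-- The right-hand side does not depend on `θ`. This is why the unnormalized visits are invariant
for the restarted chain in both states of nature and can be compared directly. -/
theorem sum_exit (h : Q.AbsorbsAt E x y) (θ : Nature) :
    ∑ i, ∑ s, Q.weight E θ i s * (Q.f i s x + Q.f i s y) = 1 - Q.g x - Q.g y := by
  have h1 := h.visits_add_visits θ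
  rw [h.visits_eq_weight, h.visits_eq_weight] at h1
  simp only [mul_add, Finset.sum_add_distrib]
  linarith

/-- Signals have full support in both states of nature, so the two chains have the same possible
paths. -/
theorem running_eq_zero (h : Q.AbsorbsAt E x y) (θ θ' : Nature) (t : ℕ) (i : Fin m)
    (h0 : Q.running E (keepSending m) θ t i = 0) :
    Q.running E (keepSending m) θ' t i = 0 := by
  induction t generalizing i with
  | zero => exact h0
  | succ t ih =>
    rw [running_succ] at h0 ⊢
    have h1 : ∀ k, 0 ≤ Q.running E (keepSending m) θ t k * (1 - Q.endProb (keepSending m) θ k) :=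
      fun k => mul_nonneg (Q.running_nonneg E _ θ t k) (sub_nonneg.2 (Q.endProb_le_one _ θ k))
    refine Finset.sum_eq_zero fun k _ => ?_
    have h2 := (Finset.sum_eq_zero_iff_of_nonneg fun k _ =>
      mul_nonneg (h1 k) (Q.trans_nonneg E θ k i)).1 h0 k (Finset.mem_univ k)
    rcases mul_eq_zero.1 h2 with h3 | h3
    · rcases mul_eq_zero.1 h3 with h4 | h4
      · rw [ih k h4]; ring
      · rw [h.endProb_keepSending] at h4
        rw [h.endProb_keepSending, h4]; ring
    · rw [trans_apply, Finset.sum_eq_zero_iff_of_nonneg fun s _ =>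
        mul_nonneg (E.sig_pos θ s).le (Q.f_nonneg k s i)] at h3
      have h5 : Q.trans E θ' k i = 0 := by
        rw [trans_apply]
        refine Finset.sum_eq_zero fun s hs => ?_
        rw [(mul_eq_zero.1 (h3 s hs)).resolve_left (E.sig_pos θ s).ne', mul_zero]
      rw [h5, mul_zero]

theorem running_eq_zero_of_visits (h : Q.AbsorbsAt E x y) {θ : Nature} {i : Fin m}
    (h0 : Q.visits E θ i = 0) (t : ℕ) : Q.running E (keepSending m) θ t i = 0 :=
  le_antisymm (((h.summable_running θ i).le_tsum t fun k _ => Q.running_nonneg E _ θ k i).trans_eq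
    h0) (Q.running_nonneg E _ θ t i)

theorem innerVisits_eq_zero (h : Q.AbsorbsAt E x y) (θ θ' : Nature) (i : Fin m)
    (h0 : Q.innerVisits E θ i = 0) : Q.innerVisits E θ' i = 0 := by
  by_cases hx : i = x
  · subst hx; exact h.innerVisits_left θ'
  by_cases hy : i = y
  · subst hy; exact h.innerVisits_right θ'
  rw [h.innerVisits_inner _ hx hy] at h0 ⊢
  unfold visits
  simp [fun t => h.running_eq_zero θ θ' t i (h.running_eq_zero_of_visits h0 t)]

theorem visitRatio_mul (h : Q.AbsorbsAt E x y) (i : Fin m) :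
    Q.visitRatio E i * Q.innerVisits E Nature.L i = Q.innerVisits E Nature.H i := by
  by_cases h0 : Q.innerVisits E Nature.L i = 0
  · rw [h0, mul_zero, h.innerVisits_eq_zero _ _ i h0]
  · exact div_mul_cancel₀ _ h0

theorem visitRatio_nonneg (Q : Protocol S m) (E : Environment S) (i : Fin m) :
    0 ≤ Q.visitRatio E i :=
  div_nonneg (innerVisits_nonneg Q E _ i) (innerVisits_nonneg Q E _ i)

theorem visitRatio_pos_iff (h : Q.AbsorbsAt E x y) (i : Fin m) :
    0 < Q.visitRatio E i ↔ 0 < Q.innerVisits E Nature.L i := by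
  constructor
  · intro hi
    refine lt_of_le_of_ne (innerVisits_nonneg Q E _ i) fun h0 => hi.ne' ?_
    rw [visitRatio, ← h0, div_zero]
  · intro hi
    refine div_pos (lt_of_le_of_ne (innerVisits_nonneg Q E _ i) fun h0 => hi.ne' ?_) hi
    exact h.innerVisits_eq_zero _ _ i h0.symm

theorem weight_high (h : Q.AbsorbsAt E x y) (i : Fin m) (s : S) :
    Q.weight E Nature.H i s = Q.visitRatio E i * E.ratio s * Q.weight E Nature.L i s := by
  rw [weight, weight, E.sig_high_eq, ← h.visitRatio_mul]
  ring

/-- Inner states that do not occur at the start and cannot be reached from elsewhere are never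
visited. -/
theorem innerVisits_eq_zero_of_closed (h : Q.AbsorbsAt E x y) (θ : Nature) (D : Finset (Fin m))
    (hg : ∀ j ∈ D, Q.g j = 0)
    (hf : ∀ j ∈ D, ∀ i, i ∉ D → ∀ s, Q.weight E θ i s * Q.f i s j = 0) :
    ∀ j ∈ D, Q.innerVisits E θ j = 0 := by
  have h1 : ∀ t, ∀ j ∈ D, Q.running E (keepSending m) θ t j = 0 := by
    intro t
    induction t with
    | zero => exact hg
    | succ t ih =>
      intro j hj
      rw [running_succ]
      refine Finset.sum_eq_zero fun i _ => ?_
      by_cases hi : i ∈ D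
      · rw [ih i hi]; ring
      by_cases h2 : Q.innerVisits E θ i = 0
      · rcases mul_eq_zero.1 h2 with h3 | h3
        · rw [h3]; ring
        · rw [h.running_eq_zero_of_visits h3 t]; ring
      · have h5 : Q.trans E θ i j = 0 := by
          rw [trans_apply]
          refine Finset.sum_eq_zero fun s _ => ?_
          rcases mul_eq_zero.1 (hf j hj i hi s) with h6 | h6
          · exact absurd ((mul_eq_zero.1 h6).resolve_right (E.sig_pos θ s).ne') h2
          · rw [h6, mul_zero]
        rw [h5, mul_zero]
  intro j hj
  simp [innerVisits, visits, fun t => h1 t j hj]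

/-- A visited inner state requires some start outside the absorbing states. This makes the
normalization in `restart` legitimate. -/
theorem start_lt_one (h : Q.AbsorbsAt E x y) {i : Fin m} (hi : 0 < Q.innerVisits E Nature.L i) :
    Q.g x + Q.g y < 1 := by
  have h0 : ∑ j ∈ (Finset.univ.erase x).erase y, Q.g j = 1 - Q.g x - Q.g y := by
    have h1 := Finset.add_sum_erase _ Q.g (Finset.mem_univ x)
    have h2 := Finset.add_sum_erase (Finset.univ.erase x) Q.g (a := y) (by simp [h.ne.symm])
    have h3 := Q.g_sum
    linarith
  have h4 : 0 ≤ ∑ j ∈ (Finset.univ.erase x).erase y, Q.g j :=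
    Finset.sum_nonneg fun j _ => Q.g_nonneg j
  by_contra hc
  have h5 : ∑ j ∈ (Finset.univ.erase x).erase y, Q.g j = 0 := by linarith
  rw [Finset.sum_eq_zero_iff_of_nonneg fun j _ => Q.g_nonneg j] at h5
  refine hi.ne' (h.innerVisits_eq_zero_of_closed Nature.L _ h5 ?_ i ?_)
  · intro j _ k hk s
    have hk' : k = x ∨ k = y := by
      by_contra hne
      push Not at hne
      exact hk (by simp [hne])
    rcases hk' with rfl | rfl
    · simp [weight, h.innerVisits_left]
    · simp [weight, h.innerVisits_right]
  · have hx : i ≠ x := by rintro rfl; exact hi.ne' (h.innerVisits_left _)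
    have hy : i ≠ y := by rintro rfl; exact hi.ne' (h.innerVisits_right _)
    simp [hx, hy]

omit [Fintype S] in
theorem restart_nonneg (hw : Q.g x + Q.g y < 1) (i : Fin m) (s : S) (j : Fin m) :
    0 ≤ Q.restart x y i s j := by
  unfold restart
  split_ifs
  · exact le_rfl
  · exact add_nonneg (Q.f_nonneg i s j) (mul_nonneg (add_nonneg (Q.f_nonneg i s x)
      (Q.f_nonneg i s y)) (div_nonneg (Q.g_nonneg j) (by linarith)))

theorem sum_inner (hxy : x ≠ y) (φ : Fin m → ℝ) :
    ∑ j, (if j = x ∨ j = y then 0 else φ j) = ∑ j, φ j - φ x - φ y := by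
  have h1 : ∀ j, (if j = x ∨ j = y then 0 else φ j) =
      φ j - (if j = x then φ x else 0) - if j = y then φ y else 0 := by
    intro j
    by_cases hx : j = x
    · subst hx; simp [hxy]
    · by_cases hy : j = y
      · subst hy; simp [hx]
      · simp [hx, hy]
  simp [h1, Finset.sum_sub_distrib]

theorem restart_sum (h : Q.AbsorbsAt E x y) (hw : Q.g x + Q.g y < 1) (i : Fin m) (s : S) :
    ∑ j, Q.restart x y i s j = 1 := by
  unfold restart
  rw [sum_inner h.ne, Finset.sum_add_distrib, Q.f_sum, ← Finset.mul_sum, ← Finset.sum_div,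
    Q.g_sum]
  have : 1 - Q.g x - Q.g y ≠ 0 := by linarith
  field_simp
  ring

/-- By `sum_exit` the total exit mass is the inner start mass, so restarts return exactly `Q.g j` to
each inner state `j`, replacing the initial term of `visits_eq_weight`. -/
theorem innerVisits_stationary (h : Q.AbsorbsAt E x y) (hw : Q.g x + Q.g y < 1) (θ : Nature)
    (j : Fin m) :
    Q.innerVisits E θ j = ∑ i, ∑ s, Q.weight E θ i s * Q.restart x y i s j := by
  by_cases hx : j = x
  · subst hx; simp [h.innerVisits_left, restart]
  by_cases hy : j = y
  · subst hy; simp [h.innerVisits_right, restart]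
  rw [h.innerVisits_inner θ hx hy, h.visits_eq_weight]
  have h1 : ∑ i, ∑ s, Q.weight E θ i s *
      ((Q.f i s x + Q.f i s y) * (Q.g j / (1 - Q.g x - Q.g y))) = Q.g j := by
    simp only [← mul_assoc, ← Finset.sum_mul, h.sum_exit]
    exact mul_div_cancel₀ _ (by linarith)
  rw [← h1]
  simp only [restart, hx, hy, or_self, if_false, mul_add (Q.weight E θ _ _) (Q.f _ _ j),
    Finset.sum_add_distrib]
  rw [h1, add_comm]

/-- The flow out of a set of memory states equals the flow into it. -/
theorem flow_balance (h : Q.AbsorbsAt E x y) (hw : Q.g x + Q.g y < 1) (θ : Nature)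
    (C : Finset (Fin m)) : Q.flow E x y θ C Cᶜ = Q.flow E x y θ Cᶜ C := by
  have h1 : ∑ j ∈ C, Q.innerVisits E θ j = Q.flow E x y θ C C + Q.flow E x y θ Cᶜ C := by
    rw [Finset.sum_congr rfl fun j _ => h.innerVisits_stationary hw θ j, Finset.sum_comm]
    unfold flow
    rw [Finset.sum_add_sum_compl]
    refine Finset.sum_congr rfl fun i _ => ?_
    rw [Finset.sum_comm]
    exact Finset.sum_congr rfl fun s _ => by rw [Finset.mul_sum]
  have h2 : ∑ j ∈ C, Q.innerVisits E θ j = Q.flow E x y θ C C + Q.flow E x y θ C Cᶜ := by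
    unfold flow
    rw [← Finset.sum_add_distrib]
    refine Finset.sum_congr rfl fun i _ => ?_
    rw [← Finset.sum_add_distrib, ← sum_weight Q E θ i]
    refine Finset.sum_congr rfl fun s _ => ?_
    rw [← mul_add, Finset.sum_add_sum_compl, h.restart_sum hw, mul_one]
  linarith

/-- By `flow_balance`, the outward and inward H-flows cancel and the L-flows combine. If `A` bounds
the H/L ratio of what leaves `C` from above and `B` that of what enters from below, both sums are
losses, and the identity gives their exact total. -/
theorem cut_defect (h : Q.AbsorbsAt E x y) (hw : Q.g x + Q.g y < 1) (C : Finset (Fin m))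
    (A B : ℝ) :
    ∑ i ∈ C, ∑ s, (A * Q.weight E Nature.L i s - Q.weight E Nature.H i s) *
        ∑ j ∈ Cᶜ, Q.restart x y i s j +
      ∑ i ∈ Cᶜ, ∑ s, (Q.weight E Nature.H i s - B * Q.weight E Nature.L i s) *
        ∑ j ∈ C, Q.restart x y i s j =
    (A - B) * Q.flow E x y Nature.L C Cᶜ := by
  have h1 := h.flow_balance hw Nature.H C
  have h2 := h.flow_balance hw Nature.L C
  have h3 : (A - B) * Q.flow E x y Nature.L C Cᶜ =
      A * Q.flow E x y Nature.L C Cᶜ - Q.flow E x y Nature.H C Cᶜ +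
        (Q.flow E x y Nature.H Cᶜ C - B * Q.flow E x y Nature.L Cᶜ C) := by
    rw [h1, h2]; ring
  rw [h3]
  unfold flow
  simp only [sub_mul, Finset.sum_sub_distrib, Finset.mul_sum, mul_assoc]

theorem flow_nonneg (hw : Q.g x + Q.g y < 1) (θ : Nature) (C D : Finset (Fin m)) :
    0 ≤ Q.flow E x y θ C D :=
  Finset.sum_nonneg fun i _ => Finset.sum_nonneg fun s _ =>
    mul_nonneg (weight_nonneg Q E θ i s) (Finset.sum_nonneg fun j _ => restart_nonneg hw i s j)

theorem weight_mul_restart_eq_zero (hw : Q.g x + Q.g y < 1) {θ : Nature} {C D : Finset (Fin m)}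
    (h0 : Q.flow E x y θ C D = 0) {i j : Fin m} (hi : i ∈ C) (hj : j ∈ D) (s : S) :
    Q.weight E θ i s * Q.restart x y i s j = 0 := by
  have hr : ∀ i s, 0 ≤ ∑ j ∈ D, Q.restart x y i s j := fun i s =>
    Finset.sum_nonneg fun j _ => restart_nonneg hw i s j
  have h1 := (Finset.sum_eq_zero_iff_of_nonneg fun i _ => Finset.sum_nonneg fun s _ =>
    mul_nonneg (weight_nonneg Q E θ i s) (hr i s)).1 h0 i hi
  have h2 := (Finset.sum_eq_zero_iff_of_nonneg fun s _ =>
    mul_nonneg (weight_nonneg Q E θ i s) (hr i s)).1 h1 s (Finset.mem_univ s)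
  rcases mul_eq_zero.1 h2 with h3 | h3
  · rw [h3, zero_mul]
  · rw [(Finset.sum_eq_zero_iff_of_nonneg fun j _ => restart_nonneg hw i s j).1 h3 j hj, mul_zero]

/-- If nothing crosses into `C`, its visited states must be fed by a start inside `C`. -/
theorem exists_start_of_flow_eq_zero (h : Q.AbsorbsAt E x y) (hw : Q.g x + Q.g y < 1)
    {C : Finset (Fin m)} (h0 : Q.flow E x y Nature.L Cᶜ C = 0) {a : Fin m} (ha : a ∈ C)
    (hva : 0 < Q.innerVisits E Nature.L a) : ∃ j ∈ C, j ≠ x ∧ j ≠ y ∧ 0 < Q.g j := by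
  by_contra hc
  push Not at hc
  have hax : a ≠ x := by rintro rfl; exact hva.ne' (h.innerVisits_left _)
  have hay : a ≠ y := by rintro rfl; exact hva.ne' (h.innerVisits_right _)
  refine hva.ne' (h.innerVisits_eq_zero_of_closed Nature.L ((C.erase x).erase y) ?_ ?_ a
    (by simp [ha, hax, hay]))
  · intro j hj
    simp only [Finset.mem_erase] at hj
    exact le_antisymm (hc j hj.2.2 hj.2.1 hj.1) (Q.g_nonneg j)
  · intro j hj i hi s
    simp only [Finset.mem_erase] at hj hi
    by_cases hix : i = x
    · subst hix; simp [weight, h.innerVisits_left]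
    by_cases hiy : i = y
    · subst hiy; simp [weight, h.innerVisits_right]
    have hiC : i ∈ Cᶜ := Finset.mem_compl.2 fun hmem => hi ⟨hiy, hix, hmem⟩
    have h1 := weight_mul_restart_eq_zero hw h0 hiC hj.2.2 s
    rcases mul_eq_zero.1 h1 with h2 | h2
    · rw [h2, zero_mul]
    · rw [restart, if_neg (by simp [hj.1, hj.2.1])] at h2
      have h3 : 0 ≤ (Q.f i s x + Q.f i s y) * (Q.g j / (1 - Q.g x - Q.g y)) :=
        mul_nonneg (add_nonneg (Q.f_nonneg i s x) (Q.f_nonneg i s y))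
          (div_nonneg (Q.g_nonneg j) (by linarith))
      have h4 : Q.f i s j = 0 := by linarith [Q.f_nonneg i s j]
      rw [h4, mul_zero]

/-- An exit would restart in `j` with positive probability and thereby cross from `C` to `D`. -/
theorem weight_mul_exit_eq_zero (hw : Q.g x + Q.g y < 1) {θ : Nature} {C D : Finset (Fin m)}
    (h0 : Q.flow E x y θ C D = 0) {i j : Fin m} (hi : i ∈ C) (hj : j ∈ D) (hjx : j ≠ x)
    (hjy : j ≠ y) (hg : 0 < Q.g j) (s : S) :
    Q.weight E θ i s * (Q.f i s x + Q.f i s y) = 0 := by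
  rcases mul_eq_zero.1 (weight_mul_restart_eq_zero hw h0 hi hj s) with h2 | h2
  · rw [h2, zero_mul]
  · rw [restart, if_neg (by simp [hjx, hjy])] at h2
    have h3 : 0 < Q.g j / (1 - Q.g x - Q.g y) := div_pos hg (by linarith)
    have h4 : 0 ≤ Q.f i s x + Q.f i s y := add_nonneg (Q.f_nonneg i s x) (Q.f_nonneg i s y)
    have h5 : (Q.f i s x + Q.f i s y) * (Q.g j / (1 - Q.g x - Q.g y)) = 0 :=
      le_antisymm (by linarith [Q.f_nonneg i s j]) (mul_nonneg h4 h3.le)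
    rw [(mul_eq_zero.1 h5).resolve_right h3.ne', mul_zero]

/-- With no flow out of `C`, balance leaves none into it. Both sides then contain a possible start,
so an exit from either side would produce a crossing. Thus no exit occurs at all, contrary to
`sum_exit`. -/
theorem flow_pos (h : Q.AbsorbsAt E x y) (hw : Q.g x + Q.g y < 1) {C : Finset (Fin m)}
    {a b : Fin m} (ha : a ∈ C) (hb : b ∉ C) (hva : 0 < Q.innerVisits E Nature.L a)
    (hvb : 0 < Q.innerVisits E Nature.L b) : 0 < Q.flow E x y Nature.L C Cᶜ := by
  refine lt_of_le_of_ne (flow_nonneg hw _ _ _) fun h0 => ?_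
  have h0 := h0.symm
  have h1 : Q.flow E x y Nature.L Cᶜ C = 0 := by rw [← h.flow_balance hw, h0]
  obtain ⟨j, hj, hjx, hjy, hgj⟩ := h.exists_start_of_flow_eq_zero hw h1 ha hva
  obtain ⟨k, hk, hkx, hky, hgk⟩ := h.exists_start_of_flow_eq_zero hw
    (C := Cᶜ) (by rw [compl_compl]; exact h0) (Finset.mem_compl.2 hb) hvb
  have h2 := h.sum_exit Nature.L
  have h3 : ∑ i, ∑ s, Q.weight E Nature.L i s * (Q.f i s x + Q.f i s y) = 0 := by
    refine Finset.sum_eq_zero fun i _ => Finset.sum_eq_zero fun s _ => ?_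
    by_cases hi : i ∈ C
    · exact weight_mul_exit_eq_zero hw h0 hi hk hkx hky hgk s
    · exact weight_mul_exit_eq_zero hw h1 (Finset.mem_compl.2 hi) hj hjx hjy hgj s
  linarith

/-- The bound is asked only of visited states: an unvisited one has `visitRatio` equal to `0 / 0 =
0`, which says nothing, but its weight vanishes. -/
theorem defect_low_nonneg (h : Q.AbsorbsAt E x y) {i : Fin m} {R : ℝ}
    (hR : 0 < Q.innerVisits E Nature.L i → Q.visitRatio E i ≤ R) (s : S) :
    0 ≤ R * E.ratioMax * Q.weight E Nature.L i s - Q.weight E Nature.H i s := by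
  rw [h.weight_high, ← sub_mul]
  rcases (innerVisits_nonneg Q E Nature.L i).eq_or_lt with h0 | h0
  · simp [weight, ← h0]
  · refine mul_nonneg (sub_nonneg.2 ?_) (weight_nonneg Q E _ i s)
    exact mul_le_mul (hR h0) (E.ratio_le_ratioMax s) (E.ratio_pos s).le
      ((visitRatio_nonneg Q E i).trans (hR h0))

theorem defect_high_nonneg (h : Q.AbsorbsAt E x y) {i : Fin m} {R : ℝ}
    (hR : 0 < Q.innerVisits E Nature.L i → R ≤ Q.visitRatio E i) (s : S) :
    0 ≤ Q.weight E Nature.H i s - R * E.ratioMin * Q.weight E Nature.L i s := by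
  rw [h.weight_high, ← sub_mul]
  rcases (innerVisits_nonneg Q E Nature.L i).eq_or_lt with h0 | h0
  · simp [weight, ← h0]
  · refine mul_nonneg (sub_nonneg.2 ?_) (weight_nonneg Q E _ i s)
    exact mul_le_mul (hR h0) (E.ratioMin_le_ratio s) E.ratioMin_pos.le (visitRatio_nonneg Q E i)

/-- Likelihood ratios of memory states on the two sides of a cut cannot be separated by a factor
larger than `γ`. -/
theorem ratio_le_of_cut (h : Q.AbsorbsAt E x y) {C : Finset (Fin m)} {a b : Fin m}
    (ha : a ∈ C) (hb : b ∉ C) (hva : 0 < Q.innerVisits E Nature.L a)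
    (hvb : 0 < Q.innerVisits E Nature.L b) {R R' : ℝ}
    (hR : ∀ i ∈ C, 0 < Q.innerVisits E Nature.L i → Q.visitRatio E i ≤ R)
    (hR' : ∀ i, i ∉ C → 0 < Q.innerVisits E Nature.L i → R' ≤ Q.visitRatio E i) :
    R' * E.ratioMin ≤ R * E.ratioMax := by
  have hw := h.start_lt_one hva
  have h1 := h.cut_defect hw C (R * E.ratioMax) (R' * E.ratioMin)
  have h2 := h.flow_pos hw ha hb hva hvb
  have h3 : 0 ≤ (R * E.ratioMax - R' * E.ratioMin) * Q.flow E x y Nature.L C Cᶜ := by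
    rw [← h1]
    refine add_nonneg ?_ ?_
    · exact Finset.sum_nonneg fun i hi => Finset.sum_nonneg fun s _ =>
        mul_nonneg (h.defect_low_nonneg (hR i hi) s)
          (Finset.sum_nonneg fun j _ => restart_nonneg hw i s j)
    · exact Finset.sum_nonneg fun i hi => Finset.sum_nonneg fun s _ =>
        mul_nonneg (h.defect_high_nonneg (hR' i (Finset.mem_compl.1 hi)) s)
          (Finset.sum_nonneg fun j _ => restart_nonneg hw i s j)
  exact sub_nonneg.1 (nonneg_of_mul_nonneg_left h3 h2)

end AbsorbsAt

end Protocol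

/-! ### Likelihood ratios of absorption and the bound on the spread of the odds -/

namespace Protocol

variable {S : Type*} {m : ℕ} [Fintype S] {E : Environment S} {Q : Protocol S m} {x y : Fin m}

namespace AbsorbsAt

/-- The initial draw has likelihood ratio 1, which is the reason for `1 ≤ A`. -/
theorem visits_high_le (h : Q.AbsorbsAt E x y) {A : ℝ} (hA : 1 ≤ A)
    (hr : ∀ i s, Q.weight E Nature.H i s ≤ A * Q.weight E Nature.L i s) (j : Fin m) :
    Q.visits E Nature.H j ≤ A * Q.visits E Nature.L j := by
  rw [h.visits_eq_weight, h.visits_eq_weight, mul_add]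
  simp only [Finset.mul_sum, ← mul_assoc]
  exact add_le_add (le_mul_of_one_le_left (Q.g_nonneg j) hA)
    (Finset.sum_le_sum fun i _ => Finset.sum_le_sum fun s _ =>
      mul_le_mul_of_nonneg_right (hr i s) (Q.f_nonneg i s j))

theorem le_visits_high (h : Q.AbsorbsAt E x y) {B : ℝ} (hB : B ≤ 1)
    (hr : ∀ i s, B * Q.weight E Nature.L i s ≤ Q.weight E Nature.H i s) (j : Fin m) :
    B * Q.visits E Nature.L j ≤ Q.visits E Nature.H j := by
  rw [h.visits_eq_weight, h.visits_eq_weight, mul_add]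
  simp only [Finset.mul_sum, ← mul_assoc]
  exact add_le_add (mul_le_of_le_one_left (Q.g_nonneg j) hB)
    (Finset.sum_le_sum fun i _ => Finset.sum_le_sum fun s _ =>
      mul_le_mul_of_nonneg_right (hr i s) (Q.f_nonneg i s j))

/-- If the likelihood ratio of absorption in `j` nearly attains its upper bound `R`, then `j` is
almost always reached along those last steps whose likelihood ratio is not bounded away from
`R`. -/
theorem last_step_concentration (h : Q.AbsorbsAt E x y) {θ θ' : Nature} {i₀ j : Fin m} {A : Set S}
    [DecidablePred (· ∈ A)] {R c Θ : ℝ} (hR : 0 < R) (hc : 0 ≤ c) (hΘ : 0 ≤ Θ)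
    (hΘ1 : Θ ≤ 1)
    (hle : ∀ i s, Q.weight E θ' i s ≤ R * Q.weight E θ i s)
    (hlt : ∀ i s, ¬ (i = i₀ ∧ s ∈ A) → Q.weight E θ' i s ≤ (1 - c) * R * Q.weight E θ i s)
    (h1 : 1 ≤ (1 - c) * R) (hv : Θ * R * Q.visits E θ j ≤ Q.visits E θ' j) :
    c * (Q.visits E θ j - ∑ s with s ∈ A, Q.weight E θ i₀ s * Q.f i₀ s j) ≤
        (1 - Θ) * Q.visits E θ j ∧
      Θ * c * (Q.visits E θ' j - ∑ s with s ∈ A, Q.weight E θ' i₀ s * Q.f i₀ s j) ≤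
        (1 - Θ) * Q.visits E θ' j := by
  classical
  set N : Nature → ℝ := fun ϑ => ∑ s with s ∈ A, Q.weight E ϑ i₀ s * Q.f i₀ s j with hN
  -- `B` collects the initial draw and all last steps outside the favoured set. Its likelihood ratio
  -- is at most `(1 - c) * R`; for the initial draw this is `h1`.
  set B : Nature → ℝ := fun ϑ => Q.g j +
    ∑ i, ∑ s, if i = i₀ ∧ s ∈ A then 0 else Q.weight E ϑ i s * Q.f i s j with hB
  have hBN : ∀ ϑ, Q.visits E ϑ j = B ϑ + N ϑ := by
    intro ϑ
    have h2 : N ϑ = ∑ i, ∑ s, if i = i₀ ∧ s ∈ A then Q.weight E ϑ i s * Q.f i s j else 0 := by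
      rw [Finset.sum_eq_single i₀ (fun i _ hi => by simp [hi]) (by simp)]
      simp [hN, Finset.sum_filter]
    rw [h2, h.visits_eq_weight, add_assoc, ← Finset.sum_add_distrib]
    congr 1
    refine Finset.sum_congr rfl fun i _ => ?_
    rw [← Finset.sum_add_distrib]
    refine Finset.sum_congr rfl fun s _ => ?_
    split_ifs <;> simp
  have hB0 : 0 ≤ B θ := by
    refine add_nonneg (Q.g_nonneg j) (Finset.sum_nonneg fun i _ => Finset.sum_nonneg fun s _ => ?_)
    split_ifs
    exacts [le_rfl, mul_nonneg (weight_nonneg Q E θ i s) (Q.f_nonneg i s j)]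
  have hBB : B θ' ≤ (1 - c) * R * B θ := by
    simp only [hB, mul_add, Finset.mul_sum]
    refine add_le_add (le_mul_of_one_le_left (Q.g_nonneg j) h1)
      (Finset.sum_le_sum fun i _ => Finset.sum_le_sum fun s _ => ?_)
    split_ifs with h3
    · simp
    · rw [← mul_assoc]
      exact mul_le_mul_of_nonneg_right (hlt i s h3) (Q.f_nonneg i s j)
  have hNN : N θ' ≤ R * N θ := by
    simp only [hN, Finset.mul_sum, ← mul_assoc]
    exact Finset.sum_le_sum fun s _ => mul_le_mul_of_nonneg_right (hle i₀ s) (Q.f_nonneg i₀ s j)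
  change c * (Q.visits E θ j - N θ) ≤ _ ∧ Θ * c * (Q.visits E θ' j - N θ') ≤ _
  rw [hBN, hBN] at hv ⊢
  have h4 : R * (c * B θ) ≤ R * ((1 - Θ) * (B θ + N θ)) := by linarith
  have h5 := le_of_mul_le_mul_left h4 hR
  have h5a : 0 ≤ c * R * B θ := by positivity
  refine ⟨by simpa using h5, ?_⟩
  have h6 : B θ' ≤ R * B θ := by linarith
  have h7 : Θ * c * B θ' ≤ Θ * c * (R * B θ) := mul_le_mul_of_nonneg_left h6 (by positivity)
  have h8 : Θ * R * (c * B θ) ≤ Θ * R * ((1 - Θ) * (B θ + N θ)) :=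
    mul_le_mul_of_nonneg_left h5 (by positivity)
  have h9 := mul_le_mul_of_nonneg_left hv (sub_nonneg.2 hΘ1)
  have e : B θ' + N θ' - N θ' = B θ' := by ring
  rw [e]
  linarith

end AbsorbsAt

/-- Memory states are labelled in increasing order of their likelihood ratios, with the absorbing
states first and last. -/
structure IsOrdered (Q : Protocol S m) (E : Environment S) (lab : ℕ → Fin m) : Prop where
  bijOn : Set.BijOn lab (Set.Icc 1 m) Set.univ
  absorbsAt : Q.AbsorbsAt E (lab 1) (lab m)
  action_last : Q.a (lab m) = 1
  action_eq_zero : ∀ i, i ≠ lab m → Q.a i = 0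
  mono : ∀ i j, 2 ≤ i → i ≤ j → j < m → Q.visitRatio E (lab i) ≤ Q.visitRatio E (lab j)

/-- Hitting frequencies are visits divided by a total that depends only on `θ`, so both ratios
induce the same order. The totals are positive once some inner state is visited; an unvisited lower
state has ratio 0. -/
theorem IsLabeling.isOrdered {lab : ℕ → Fin m} (hlab : Q.IsLabeling E lab)
    (hQ : Q.IsParsimonious E) : Q.IsOrdered E lab := by
  obtain ⟨hbij, h1, ha1, hm, ham, hmono⟩ := hlab
  obtain ⟨x, y, hxy, hx, hax, hy, hay, hT⟩ := hQ
  have key : ∀ i, Q.IsAbsorbing i → i = x ∨ i = y := by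
    intro i hi
    by_contra hc
    push Not at hc
    exact hi.not_isTransient Nature.H ((hT i hc.1 hc.2).1 Nature.H)
  have e1 : lab 1 = x := by
    rcases key _ h1 with h | h
    · exact h
    · rw [h, hay] at ha1; norm_num at ha1
  have em : lab m = y := by
    rcases key _ hm with h | h
    · rw [h, hax] at ham; norm_num at ham
    · exact h
  have hA : Q.AbsorbsAt E (lab 1) (lab m) := by
    rw [e1, em]
    exact ⟨hxy, hx, hy, fun i hix hiy => (hT i hix hiy).1⟩
  refine ⟨hbij, hA, ham, ?_, ?_⟩
  · intro i hi
    by_cases hix : i = x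
    · rw [hix, hax]
    · exact (hT i hix (em ▸ hi)).2
  · intro i j hi hij hj
    have hne : ∀ k, 2 ≤ k → k < m → lab k ≠ lab 1 ∧ lab k ≠ lab m := by
      intro k hk hkm
      have hinj := hbij.injOn
      constructor
      · intro he
        have := hinj (x₁ := k) (x₂ := 1) ⟨by omega, by omega⟩ ⟨by omega, by omega⟩ he
        omega
      · intro he
        have := hinj (x₁ := k) (x₂ := m) ⟨by omega, by omega⟩ ⟨by omega, by omega⟩ he
        omega
    have hvi : ∀ k, 2 ≤ k → k < m → ∀ θ, Q.innerVisits E θ (lab k) = Q.visits E θ (lab k) :=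
      fun k hk hkm θ => hA.innerVisits_inner θ (hne k hk hkm).1 (hne k hk hkm).2
    have hi' := hvi i hi (by omega)
    have hj' := hvi j (by omega) hj
    by_cases h0 : Q.innerVisits E Nature.L (lab i) = 0
    · have : Q.visitRatio E (lab i) = 0 := by rw [visitRatio, h0, div_zero]
      rw [this]
      exact AbsorbsAt.visitRatio_nonneg Q E _
    have h0' : Q.innerVisits E Nature.H (lab i) ≠ 0 := fun hz => h0 (hA.innerVisits_eq_zero _ _ _ hz)
    classical
    have hZ : ∀ θ, Q.innerVisits E θ (lab i) ≠ 0 →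
        0 < ∑ k with Q.IsTransient E θ k, Q.visits E θ k := by
      intro θ hθ
      refine lt_of_lt_of_le (lt_of_le_of_ne (AbsorbsAt.visits_nonneg Q E θ (lab i)) ?_)
        (Finset.single_le_sum (f := fun k => Q.visits E θ k)
          (fun k _ => AbsorbsAt.visits_nonneg Q E θ k) (a := lab i) ?_)
      · rw [← hi']; exact hθ.symm
      · have := hne i hi (by omega)
        simpa using hA.transient _ this.1 this.2 θ
    have hZH := hZ _ h0'
    have hZL := hZ _ h0
    have hm' := hmono i j hi hij hj
    unfold hitFreq at hm'
    unfold visitRatio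
    rw [hi', hi', hj', hj']
    rw [div_div_div_comm, div_div_div_comm (Q.visits E Nature.H (lab j))] at hm'
    exact (div_le_div_iff_of_pos_right (div_pos hZH hZL)).1 hm'

namespace IsOrdered

variable {lab : ℕ → Fin m}

theorem exists_label (h : Q.IsOrdered E lab) (k : Fin m) : ∃ i, 1 ≤ i ∧ i ≤ m ∧ lab i = k := by
  obtain ⟨i, hi, rfl⟩ := h.bijOn.surjOn (Set.mem_univ k)
  exact ⟨i, hi.1, hi.2, rfl⟩

theorem label_inj (h : Q.IsOrdered E lab) {i j : ℕ} (hi : 1 ≤ i) (hi' : i ≤ m) (hj : 1 ≤ j)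
    (hj' : j ≤ m) (he : lab i = lab j) : i = j :=
  h.bijOn.injOn ⟨hi, hi'⟩ ⟨hj, hj'⟩ he

/-- The memory states with labels `1, …, k`. -/
def lower (lab : ℕ → Fin m) (k : ℕ) : Finset (Fin m) := (Finset.Icc 1 k).image lab

theorem mem_lower (h : Q.IsOrdered E lab) {i k : ℕ} (hk : k ≤ m) (hi : 1 ≤ i) (him : i ≤ m) :
    lab i ∈ lower lab k ↔ i ≤ k := by
  unfold lower
  simp only [Finset.mem_image, Finset.mem_Icc]
  constructor
  · rintro ⟨j, hj, he⟩
    have := h.label_inj hj.1 (hj.2.trans hk) hi him he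
    omega
  · intro hik
    exact ⟨i, ⟨hi, hik⟩, rfl⟩

/-- A visited inner state has a label between `2` and `m - 1`. -/
theorem exists_inner_label (h : Q.IsOrdered E lab) {k : Fin m}
    (hk : 0 < Q.innerVisits E Nature.L k) : ∃ i, 2 ≤ i ∧ i < m ∧ lab i = k := by
  obtain ⟨i, hi, him, rfl⟩ := h.exists_label k
  have h1 : i ≠ 1 := by rintro rfl; exact hk.ne' (h.absorbsAt.innerVisits_left _)
  have h2 : i ≠ m := by rintro rfl; exact hk.ne' (h.absorbsAt.innerVisits_right _)
  exact ⟨i, by omega, by omega, rfl⟩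

theorem visitRatio_pos (h : Q.IsOrdered E lab) {i j : ℕ} (hi : 2 ≤ i) (hij : i ≤ j) (hj : j < m)
    (h0 : 0 < Q.visitRatio E (lab i)) : 0 < Q.visitRatio E (lab j) :=
  h0.trans_le (h.mono i j hi hij hj)

theorem visitRatio_le_of_mem_lower (h : Q.IsOrdered E lab) {k : ℕ} (hk : k < m) {i : Fin m}
    (hi : i ∈ lower lab k) (hv : 0 < Q.innerVisits E Nature.L i) :
    Q.visitRatio E i ≤ Q.visitRatio E (lab k) := by
  obtain ⟨j, hj, hjm, rfl⟩ := h.exists_inner_label hv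
  exact h.mono j k hj ((h.mem_lower hk.le (by omega) hjm.le).1 hi) hk

theorem le_visitRatio_of_notMem_lower (h : Q.IsOrdered E lab) {k : ℕ} (hk : 1 ≤ k) (hkm : k < m)
    {i : Fin m} (hi : i ∉ lower lab k) (hv : 0 < Q.innerVisits E Nature.L i) :
    Q.visitRatio E (lab (k + 1)) ≤ Q.visitRatio E i := by
  obtain ⟨j, hj, hjm, rfl⟩ := h.exists_inner_label hv
  rw [h.mem_lower hkm.le (by omega) hjm.le] at hi
  exact h.mono (k + 1) j (by omega) (by omega) hjm

/-- The cut runs between the labels `i` and `i + 1`. Positivity matters: unvisited states have ratio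
0 and come first, and no factor bounds the jump from 0. -/
theorem visitRatio_succ_le (h : Q.IsOrdered E lab) {i : ℕ} (hi : 2 ≤ i) (him : i + 1 < m)
    (h0 : 0 < Q.visitRatio E (lab i)) :
    Q.visitRatio E (lab (i + 1)) ≤ E.gamma * Q.visitRatio E (lab i) := by
  have hA := h.absorbsAt
  have h1 := hA.ratio_le_of_cut (C := lower lab i) (a := lab i) (b := lab (i + 1))
    ((h.mem_lower (by omega) (by omega) (by omega)).2 le_rfl)
    (fun hc => absurd ((h.mem_lower (by omega) (by omega) (by omega)).1 hc) (by omega))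
    ((hA.visitRatio_pos_iff _).1 h0)
    ((hA.visitRatio_pos_iff _).1 (h.visitRatio_pos hi (by omega) him h0))
    (fun j hj => h.visitRatio_le_of_mem_lower (by omega) hj)
    (fun j hj => h.le_visitRatio_of_notMem_lower (by omega) (by omega) hj)
  rw [← E.gamma_mul_ratioMin] at h1
  refine le_of_mul_le_mul_right (h1.trans_eq ?_) E.ratioMin_pos
  ring

theorem visitRatio_le_pow (h : Q.IsOrdered E lab) {i : ℕ} (hi : 2 ≤ i)
    (h0 : 0 < Q.visitRatio E (lab i)) (d : ℕ) (hd : i + d < m) :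
    Q.visitRatio E (lab (i + d)) ≤ E.gamma ^ d * Q.visitRatio E (lab i) := by
  induction d with
  | zero => simp
  | succ d ih =>
    have h1 := h.visitRatio_succ_le (i := i + d) (by omega) (by omega)
      (h.visitRatio_pos hi (by omega) (by omega) h0)
    refine h1.trans ?_
    rw [pow_succ', mul_assoc]
    exact mul_le_mul_of_nonneg_left (ih (by omega)) (zero_le_one.trans E.one_lt_gamma.le)

theorem weight_high_le (h : Q.IsOrdered E lab) (hm : 3 ≤ m) (i : Fin m) (s : S) :
    Q.weight E Nature.H i s ≤
      Q.visitRatio E (lab (m - 1)) * E.ratioMax * Q.weight E Nature.L i s :=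
  sub_nonneg.1 (h.absorbsAt.defect_low_nonneg (fun hv => by
    obtain ⟨j, hj, hjm, rfl⟩ := h.exists_inner_label hv
    exact h.mono j (m - 1) hj (by omega) (by omega)) s)

theorem le_weight_high (h : Q.IsOrdered E lab) {i₀ : ℕ}
    (h0 : ∀ i, 2 ≤ i → i < m → 0 < Q.visitRatio E (lab i) →
      Q.visitRatio E (lab i₀) ≤ Q.visitRatio E (lab i)) (i : Fin m) (s : S) :
    Q.visitRatio E (lab i₀) * E.ratioMin * Q.weight E Nature.L i s ≤ Q.weight E Nature.H i s :=
  sub_nonneg.1 (h.absorbsAt.defect_high_nonneg (fun hv => by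
    obtain ⟨j, hj, hjm, rfl⟩ := h.exists_inner_label hv
    exact h0 j hj hjm ((h.absorbsAt.visitRatio_pos_iff _).2 hv)) s)

theorem visits_first (h : Q.IsOrdered E lab) (θ : Nature) :
    Q.visits E θ (lab 1) = 1 - Q.visits E θ (lab m) := by
  linarith [h.absorbsAt.visits_add_visits θ]

/-- If action `H` is more likely in state `H`, then some inner state has the likelihood ratio
needed for that, at either end. -/
theorem bounds_of_lt (h : Q.IsOrdered E lab) (hm : 3 ≤ m)
    (hlt : Q.visits E Nature.L (lab m) < Q.visits E Nature.H (lab m)) {i₀ : ℕ}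
    (h0 : ∀ i, 2 ≤ i → i < m → 0 < Q.visitRatio E (lab i) →
      Q.visitRatio E (lab i₀) ≤ Q.visitRatio E (lab i)) :
    (1 < Q.visitRatio E (lab (m - 1)) * E.ratioMax ∧
      Q.visits E Nature.H (lab m) ≤
        Q.visitRatio E (lab (m - 1)) * E.ratioMax * Q.visits E Nature.L (lab m)) ∧
    (Q.visitRatio E (lab i₀) * E.ratioMin < 1 ∧
      Q.visitRatio E (lab i₀) * E.ratioMin * (1 - Q.visits E Nature.L (lab m)) ≤
        1 - Q.visits E Nature.H (lab m)) := by
  -- Otherwise every last step, like the initial draw, has likelihood ratio at most 1, and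
  -- absorption in `lab m` cannot be likelier under H. The other end is analogous.
  have h1 : 1 < Q.visitRatio E (lab (m - 1)) * E.ratioMax := by
    by_contra hc
    push Not at hc
    have := h.absorbsAt.visits_high_le (le_refl 1) (fun i s => (h.weight_high_le hm i s).trans
      (mul_le_mul_of_nonneg_right hc (AbsorbsAt.weight_nonneg Q E _ i s))) (lab m)
    linarith
  have h2 : Q.visitRatio E (lab i₀) * E.ratioMin < 1 := by
    by_contra hc
    push Not at hc
    have := h.absorbsAt.le_visits_high (le_refl 1) (fun i s => le_trans
      (mul_le_mul_of_nonneg_right hc (AbsorbsAt.weight_nonneg Q E _ i s))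
      (h.le_weight_high h0 i s)) (lab 1)
    rw [h.visits_first, h.visits_first] at this
    linarith
  have h3 := h.absorbsAt.le_visits_high h2.le (h.le_weight_high h0) (lab 1)
  rw [h.visits_first, h.visits_first] at h3
  exact ⟨⟨h1, h.absorbsAt.visits_high_le h1.le (h.weight_high_le hm) (lab m)⟩, h2, h3⟩

theorem visits_last_le_one (h : Q.IsOrdered E lab) (θ : Nature) : Q.visits E θ (lab m) ≤ 1 := by
  linarith [h.absorbsAt.visits_add_visits θ, AbsorbsAt.visits_nonneg Q E θ (lab 1)]

theorem odds_le_of_not_lt (h : Q.IsOrdered E lab)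
    (hlt : ¬ Q.visits E Nature.L (lab m) < Q.visits E Nature.H (lab m)) (d : ℕ) :
    Q.visits E Nature.H (lab m) * (1 - Q.visits E Nature.L (lab m)) ≤
      E.gamma ^ d * (Q.visits E Nature.L (lab m) * (1 - Q.visits E Nature.H (lab m))) := by
  have h1 := h.visits_last_le_one Nature.H
  have h2 := AbsorbsAt.visits_nonneg Q E Nature.L (lab m)
  have h3 : 1 ≤ E.gamma ^ d := one_le_pow₀ E.one_lt_gamma.le
  refine le_trans ?_ (le_mul_of_one_le_left (mul_nonneg h2 (sub_nonneg.2 h1)) h3)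
  linarith

/-- This is the product of the two end bounds. The inner ratios spread by at most `γ ^ (m - 1 -
i₀)`, and the extreme signals at the two ends supply one more `γ`. -/
theorem odds_le_of_lt (h : Q.IsOrdered E lab) (hm : 3 ≤ m)
    (hlt : Q.visits E Nature.L (lab m) < Q.visits E Nature.H (lab m)) {i₀ : ℕ} (hi : 2 ≤ i₀)
    (him : i₀ < m) (hpos : 0 < Q.visitRatio E (lab i₀))
    (h0 : ∀ i, 2 ≤ i → i < m → 0 < Q.visitRatio E (lab i) →
      Q.visitRatio E (lab i₀) ≤ Q.visitRatio E (lab i)) :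
    Q.visits E Nature.H (lab m) * (1 - Q.visits E Nature.L (lab m)) ≤
      E.gamma ^ (m - i₀) * (Q.visits E Nature.L (lab m) * (1 - Q.visits E Nature.H (lab m))) := by
  obtain ⟨⟨h1, h2⟩, h3, h4⟩ := h.bounds_of_lt hm hlt h0
  have h5 := h.visitRatio_le_pow hi hpos (m - 1 - i₀) (by omega)
  rw [show i₀ + (m - 1 - i₀) = m - 1 by omega] at h5
  set a := Q.visits E Nature.H (lab m)
  set b := Q.visits E Nature.L (lab m)
  have ha := h.visits_last_le_one Nature.H
  have hb : 0 ≤ b := AbsorbsAt.visits_nonneg Q E Nature.L (lab m)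
  have hr : 0 < Q.visitRatio E (lab i₀) * E.ratioMin := mul_pos hpos E.ratioMin_pos
  have h6 : a * (Q.visitRatio E (lab i₀) * E.ratioMin * (1 - b)) ≤
      Q.visitRatio E (lab (m - 1)) * E.ratioMax * b * (1 - a) :=
    mul_le_mul h2 h4 (mul_nonneg hr.le (by linarith)) (mul_nonneg (by linarith) hb)
  have h7 : Q.visitRatio E (lab (m - 1)) * E.ratioMax * b * (1 - a) ≤
      E.gamma ^ (m - 1 - i₀) * Q.visitRatio E (lab i₀) * E.ratioMax * b * (1 - a) := by
    have := E.ratioMax_pos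
    have : 0 ≤ 1 - a := sub_nonneg.2 ha
    gcongr
  have h8 : E.gamma ^ (m - i₀) = E.gamma ^ (m - 1 - i₀) * E.gamma := by
    rw [← pow_succ]; congr 1; omega
  rw [h8]
  refine le_of_mul_le_mul_left ?_ hr
  rw [← E.gamma_mul_ratioMin] at h6 h7
  linarith

/-- Either the inner state with the smallest label is visited, or the spread of the absorption
odds is smaller than the maximal one by a factor `γ`. -/
theorem odds_le_or (h : Q.IsOrdered E lab) (hm : 4 ≤ m) :
    Q.visits E Nature.H (lab m) * (1 - Q.visits E Nature.L (lab m)) ≤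
      E.gamma ^ (m - 3) * (Q.visits E Nature.L (lab m) * (1 - Q.visits E Nature.H (lab m))) ∨
    (Q.visits E Nature.L (lab m) < Q.visits E Nature.H (lab m) ∧
      0 < Q.visitRatio E (lab 2)) := by
  by_cases hlt : Q.visits E Nature.L (lab m) < Q.visits E Nature.H (lab m)
  swap
  · exact Or.inl (h.odds_le_of_not_lt hlt _)
  by_cases h2 : 0 < Q.visitRatio E (lab 2)
  · exact Or.inr ⟨hlt, h2⟩
  left
  -- If no inner state were visited, the top ratio would be 0, against `1 < 0 * ratioMax` from the
  -- end bound.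
  have hex : ∃ i, 2 ≤ i ∧ i < m ∧ 0 < Q.visitRatio E (lab i) := by
    by_contra hc
    push Not at hc
    have h3 := h.bounds_of_lt (by omega) hlt (i₀ := 2) (fun i hi him hp =>
      absurd hp (not_lt.2 (hc i hi him)))
    have h4 := hc (m - 1) (by omega) (by omega)
    nlinarith [E.ratioMax_pos, h3.1.1]
  classical
  -- The lowest visited label takes over the role of 2. It is at least 3, which costs one factor
  -- `γ`.
  obtain ⟨hi, him, hpos⟩ := Nat.find_spec hex
  set i₀ := Nat.find hex
  have h3 := h.odds_le_of_lt (by omega) hlt hi him hpos (fun i hi' him' hp =>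
    h.mono i₀ i hi (Nat.find_min' hex ⟨hi', him', hp⟩) him')
  have hne : i₀ ≠ 2 := by intro he; rw [he] at hpos; exact h2 hpos
  refine h3.trans (mul_le_mul_of_nonneg_right
    (pow_le_pow_right₀ E.one_lt_gamma.le (by omega)) ?_)
  exact mul_nonneg (AbsorbsAt.visits_nonneg Q E _ _) (sub_nonneg.2 (h.visits_last_le_one _))

/-- The absorption odds in the two states of nature differ at most by the factor `γ ^ (m - 2)`. -/
theorem odds_le (h : Q.IsOrdered E lab) (hm : 4 ≤ m) :
    Q.visits E Nature.H (lab m) * (1 - Q.visits E Nature.L (lab m)) ≤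
      E.gamma ^ (m - 2) * (Q.visits E Nature.L (lab m) * (1 - Q.visits E Nature.H (lab m))) := by
  rcases h.odds_le_or hm with h1 | ⟨h1, h2⟩
  · refine h1.trans (mul_le_mul_of_nonneg_right
      (pow_le_pow_right₀ E.one_lt_gamma.le (by omega)) ?_)
    exact mul_nonneg (AbsorbsAt.visits_nonneg Q E _ _) (sub_nonneg.2 (h.visits_last_le_one _))
  · exact h.odds_le_of_lt (by omega) h1 le_rfl (by omega) h2
      (fun i hi him _ => h.mono 2 i le_rfl hi him)

end IsOrdered

end Protocol

/-! ### Near-extremal protocols: last steps and diverging visits -/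

namespace Protocol

variable {S : Type*} {m : ℕ} [Fintype S] {E : Environment S} {Q : Protocol S m} {x y : Fin m}

/-- Probability that a fresh start, at an inner state, is in `D`. -/
def startMass (Q : Protocol S m) (x y : Fin m) (D : Finset (Fin m)) : ℝ :=
  ∑ j ∈ D, if j = x ∨ j = y then 0 else Q.g j / (1 - Q.g x - Q.g y)

namespace AbsorbsAt

theorem startMass_add_compl (h : Q.AbsorbsAt E x y) (hw : Q.g x + Q.g y < 1)
    (C : Finset (Fin m)) : Q.startMass x y C + Q.startMass x y Cᶜ = 1 := by
  unfold startMass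
  rw [Finset.sum_add_sum_compl, sum_inner h.ne, ← Finset.sum_div, Q.g_sum, ← sub_div, ← sub_div]
  exact div_self (by linarith)

omit [Fintype S] in
theorem startMass_nonneg (hw : Q.g x + Q.g y < 1) (C : Finset (Fin m)) :
    0 ≤ Q.startMass x y C := by
  refine Finset.sum_nonneg fun j _ => ?_
  split_ifs
  exacts [le_rfl, div_nonneg (Q.g_nonneg j) (by linarith)]

omit [Fintype S] in
theorem exit_mul_startMass_le (D : Finset (Fin m)) (i : Fin m) (s : S) :
    (Q.f i s x + Q.f i s y) * Q.startMass x y D ≤ ∑ j ∈ D, Q.restart x y i s j := by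
  unfold startMass restart
  rw [Finset.mul_sum]
  refine Finset.sum_le_sum fun j _ => ?_
  split_ifs
  · simp
  · exact le_add_of_nonneg_left (Q.f_nonneg i s j)

omit [Fintype S] in
theorem sum_restart_nonneg (hw : Q.g x + Q.g y < 1) (D : Finset (Fin m)) (i : Fin m) (s : S) :
    0 ≤ ∑ j ∈ D, Q.restart x y i s j :=
  Finset.sum_nonneg fun j _ => restart_nonneg hw i s j

theorem sum_restart_le_one (h : Q.AbsorbsAt E x y) (hw : Q.g x + Q.g y < 1) (D : Finset (Fin m))
    (i : Fin m) (s : S) : ∑ j ∈ D, Q.restart x y i s j ≤ 1 := by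
  rw [← h.restart_sum hw i s]
  exact Finset.sum_le_sum_of_subset_of_nonneg (Finset.subset_univ D)
    fun j _ _ => restart_nonneg hw i s j

/-- If the flow from the states of `C` other than `i₀` is at most half of the flow from `C`, then
`i₀` is visited at least half as often as the flow. -/
theorem flow_le_of_single (h : Q.AbsorbsAt E x y) (hw : Q.g x + Q.g y < 1) {C D : Finset (Fin m)}
    {i₀ : Fin m} (hi₀ : i₀ ∈ C)
    (hF : 2 * ∑ i ∈ C.erase i₀, ∑ s, Q.weight E Nature.L i s * ∑ j ∈ D, Q.restart x y i s j ≤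
      Q.flow E x y Nature.L C D) :
    Q.flow E x y Nature.L C D ≤ 2 * Q.innerVisits E Nature.L i₀ := by
  have h1 : ∑ s, Q.weight E Nature.L i₀ s * ∑ j ∈ D, Q.restart x y i₀ s j ≤
      Q.innerVisits E Nature.L i₀ := by
    rw [← sum_weight Q E Nature.L i₀]
    exact Finset.sum_le_sum fun s _ =>
      mul_le_of_le_one_right (weight_nonneg Q E _ _ s) (h.sum_restart_le_one hw D i₀ s)
  have h2 : Q.flow E x y Nature.L C D =
      ∑ s, Q.weight E Nature.L i₀ s * ∑ j ∈ D, Q.restart x y i₀ s j +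
      ∑ i ∈ C.erase i₀, ∑ s, Q.weight E Nature.L i s * ∑ j ∈ D, Q.restart x y i s j :=
    (Finset.add_sum_erase _ _ hi₀).symm
  linarith

/-- The expected number of exits is at most one in total, so a state that is visited often must exit
rarely. -/
theorem innerVisits_mul_exit_le (h : Q.AbsorbsAt E x y) (θ : Nature) (i : Fin m) (s : S) :
    Q.weight E θ i s * (Q.f i s x + Q.f i s y) ≤ 1 := by
  have h1 := h.sum_exit θ
  have h2 : ∀ i s, 0 ≤ Q.weight E θ i s * (Q.f i s x + Q.f i s y) := fun i s =>
    mul_nonneg (weight_nonneg Q E θ i s) (add_nonneg (Q.f_nonneg i s x) (Q.f_nonneg i s y))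
  calc Q.weight E θ i s * (Q.f i s x + Q.f i s y)
      ≤ ∑ s, Q.weight E θ i s * (Q.f i s x + Q.f i s y) :=
        Finset.single_le_sum (f := fun s => Q.weight E θ i s * (Q.f i s x + Q.f i s y))
          (fun s _ => h2 i s) (Finset.mem_univ s)
    _ ≤ ∑ i, ∑ s, Q.weight E θ i s * (Q.f i s x + Q.f i s y) :=
        Finset.single_le_sum (f := fun i => ∑ s, Q.weight E θ i s * (Q.f i s x + Q.f i s y))
          (fun i _ => Finset.sum_nonneg fun s _ => h2 i s) (Finset.mem_univ i)
    _ ≤ 1 := by linarith [Q.g_nonneg x, Q.g_nonneg y]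

end AbsorbsAt

namespace IsOrdered

variable {lab : ℕ → Fin m}

theorem visits_pos (h : Q.IsOrdered E lab) (hm : 4 ≤ m)
    (hlt : Q.visits E Nature.L (lab m) < Q.visits E Nature.H (lab m))
    (hpos : 0 < Q.visitRatio E (lab 2)) :
    0 < Q.visits E Nature.L (lab m) ∧ Q.visits E Nature.H (lab m) < 1 := by
  obtain ⟨⟨h1, h2⟩, h3, h4⟩ := h.bounds_of_lt (by omega) hlt (i₀ := 2)
    (fun i hi him _ => h.mono 2 i le_rfl hi him)
  have hb : 0 ≤ Q.visits E Nature.L (lab m) := AbsorbsAt.visits_nonneg Q E _ _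
  have ha := h.visits_last_le_one Nature.H
  constructor
  · refine lt_of_le_of_ne hb fun h0 => ?_
    rw [← h0] at h2 hlt
    linarith
  · have := mul_pos (mul_pos hpos E.ratioMin_pos)
      (show 0 < 1 - Q.visits E Nature.L (lab m) by linarith)
    linarith

/-- If the absorption odds have nearly the maximal spread, then every inequality in the derivation
of the bound on the spread is nearly an equality. -/
theorem near_equalities (h : Q.IsOrdered E lab) (hm : 4 ≤ m)
    (hlt : Q.visits E Nature.L (lab m) < Q.visits E Nature.H (lab m))
    (hpos : 0 < Q.visitRatio E (lab 2)) {Θ : ℝ} (hΘ0 : 0 ≤ Θ)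
    (hΘ : Θ * E.gamma ^ (m - 2) *
        (Q.visits E Nature.L (lab m) * (1 - Q.visits E Nature.H (lab m))) ≤
      Q.visits E Nature.H (lab m) * (1 - Q.visits E Nature.L (lab m))) :
    Θ * (Q.visitRatio E (lab (m - 1)) * E.ratioMax) * Q.visits E Nature.L (lab m) ≤
        Q.visits E Nature.H (lab m) ∧
    Θ * (1 - Q.visits E Nature.H (lab m)) ≤
        Q.visitRatio E (lab 2) * E.ratioMin * (1 - Q.visits E Nature.L (lab m)) ∧
    ∀ c, 2 ≤ c → c + 1 < m →
      Θ * E.gamma * Q.visitRatio E (lab c) ≤ Q.visitRatio E (lab (c + 1)) := by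
  obtain ⟨⟨h1, h2⟩, h3, h4⟩ := h.bounds_of_lt (by omega) hlt (i₀ := 2)
    (fun i hi him _ => h.mono 2 i le_rfl hi him)
  obtain ⟨hb, ha⟩ := h.visits_pos hm hlt hpos
  have h5 := h.visitRatio_le_pow le_rfl hpos (m - 3) (by omega)
  rw [show 2 + (m - 3) = m - 1 by omega] at h5
  have hγ : 0 < E.gamma := zero_lt_one.trans E.one_lt_gamma
  have hl := E.ratioMin_pos
  have hL := E.ratioMax_pos
  have hG : E.gamma ^ (m - 2) * E.ratioMin = E.gamma ^ (m - 3) * E.ratioMax := by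
    rw [← E.gamma_mul_ratioMin, ← mul_assoc, ← pow_succ]; congr 2; omega
  set a := Q.visits E Nature.H (lab m)
  set b := Q.visits E Nature.L (lab m)
  set G := E.gamma ^ (m - 2)
  set r := Q.visitRatio E (lab 2)
  set R := Q.visitRatio E (lab (m - 1))
  have hb1 : 0 < 1 - b := by linarith
  have ha1 : 0 < 1 - a := by linarith
  -- The spread bound multiplies `h2`, `h4` and `h5`. Each claim follows from `hΘ` by inserting the
  -- estimates other than the one in question and cancelling.
  refine ⟨?_, ?_, ?_⟩
  · refine le_of_mul_le_mul_right ?_ hb1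
    refine le_trans ?_ hΘ
    have e1 : Θ * b * (R * E.ratioMax * (1 - b)) ≤
        Θ * b * (E.gamma ^ (m - 3) * r * E.ratioMax * (1 - b)) := by gcongr
    have e2 : Θ * b * G * (r * E.ratioMin * (1 - b)) ≤ Θ * b * G * (1 - a) := by gcongr
    have e3 : Θ * b * (E.gamma ^ (m - 3) * r * E.ratioMax * (1 - b)) =
        Θ * b * G * (r * E.ratioMin * (1 - b)) := by
      linear_combination (-(Θ * b * r * (1 - b))) * hG
    linarith
  · have hGp : 0 < G := pow_pos hγ _
    refine le_of_mul_le_mul_left ?_ (mul_pos hGp hb)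
    have e1 : a * (1 - b) ≤ R * E.ratioMax * b * (1 - b) := by gcongr
    have e2 : R * E.ratioMax * b * (1 - b) ≤
        E.gamma ^ (m - 3) * r * E.ratioMax * b * (1 - b) := by gcongr
    have e3 : E.gamma ^ (m - 3) * r * E.ratioMax * b * (1 - b) =
        G * b * (r * E.ratioMin * (1 - b)) := by
      linear_combination (-(r * b * (1 - b))) * hG
    linarith
  · intro c hc hcm
    have e1 : Θ * G * (b * (1 - a)) * (r * E.ratioMin) ≤ a * (1 - b) * (r * E.ratioMin) := by
      gcongr
    have e2 : a * (r * E.ratioMin * (1 - b)) ≤ R * E.ratioMax * b * (1 - a) := by gcongr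
    have e3 : b * (1 - a) * (Θ * G * (r * E.ratioMin)) ≤ b * (1 - a) * (R * E.ratioMax) := by
      linarith
    have e4 := le_of_mul_le_mul_left e3 (mul_pos hb ha1)
    have e5 : E.ratioMax * (Θ * E.gamma ^ (m - 3) * r) ≤ E.ratioMax * R := by
      have : Θ * G * (r * E.ratioMin) = E.ratioMax * (Θ * E.gamma ^ (m - 3) * r) := by
        linear_combination (Θ * r) * hG
      linarith
    have e6 := le_of_mul_le_mul_left e5 hL
    -- All steps from label 2 to `m - 1` except the one from `c` to `c + 1` are bounded by `γ`, so
    -- this one must supply the remaining factor `Θ * γ`.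
    have e7 := h.visitRatio_le_pow (i := c + 1) (by omega)
      (h.visitRatio_pos le_rfl (by omega) hcm hpos) (m - 2 - c) (by omega)
    rw [show c + 1 + (m - 2 - c) = m - 1 by omega] at e7
    have e8 := h.visitRatio_le_pow le_rfl hpos (c - 2) (by omega)
    rw [show 2 + (c - 2) = c by omega] at e8
    have e9 : E.gamma ^ (m - 3) = E.gamma ^ (m - 2 - c) * E.gamma * E.gamma ^ (c - 2) *
        (E.gamma ^ 0) := by
      rw [pow_zero, mul_one, ← pow_succ, ← pow_add]; congr 1; omega
    rw [pow_zero, mul_one] at e9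
    refine le_of_mul_le_mul_left ?_ (pow_pos hγ (m - 2 - c))
    calc E.gamma ^ (m - 2 - c) * (Θ * E.gamma * Q.visitRatio E (lab c))
        ≤ E.gamma ^ (m - 2 - c) * (Θ * E.gamma * (E.gamma ^ (c - 2) * r)) := by gcongr
      _ = Θ * E.gamma ^ (m - 3) * r := by rw [e9]; ring
      _ ≤ R := e6
      _ ≤ _ := e7

/-- Absorption in the last state takes place almost always from the state below, upon a signal with
the largest likelihood ratio. -/
theorem last_step_high (h : Q.IsOrdered E lab) (hm : 4 ≤ m)
    (hpos : 0 < Q.visitRatio E (lab 2)) {A : Set S} [DecidablePred (· ∈ A)] {Θ c : ℝ}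
    (hΘ0 : 0 ≤ Θ) (hΘ1 : Θ ≤ 1) (hc : 0 ≤ c) (hc1 : c ≤ 1)
    (hv : Θ * (Q.visitRatio E (lab (m - 1)) * E.ratioMax) * Q.visits E Nature.L (lab m) ≤
      Q.visits E Nature.H (lab m))
    (hgap : ∀ s, s ∉ A → E.ratio s ≤ (1 - c) * E.ratioMax)
    (hr : Q.visitRatio E (lab (m - 2)) ≤ (1 - c) * Q.visitRatio E (lab (m - 1)))
    (h1 : 1 ≤ (1 - c) * (Q.visitRatio E (lab (m - 1)) * E.ratioMax)) :
    c * (Q.visits E Nature.L (lab m) - ∑ s with s ∈ A,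
        Q.weight E Nature.L (lab (m - 1)) s * Q.f (lab (m - 1)) s (lab m)) ≤
        (1 - Θ) * Q.visits E Nature.L (lab m) ∧
      Θ * c * (Q.visits E Nature.H (lab m) - ∑ s with s ∈ A,
        Q.weight E Nature.H (lab (m - 1)) s * Q.f (lab (m - 1)) s (lab m)) ≤
        (1 - Θ) * Q.visits E Nature.H (lab m) := by
  have hRp := h.visitRatio_pos (i := 2) (j := m - 1) le_rfl (by omega) (by omega) hpos
  have hL := E.ratioMax_pos
  have hc' : 0 ≤ 1 - c := sub_nonneg.2 hc1
  refine h.absorbsAt.last_step_concentration (mul_pos hRp hL) hc hΘ0 hΘ1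
    (h.weight_high_le (by omega)) ?_ h1 hv
  intro i s hs
  rw [h.absorbsAt.weight_high]
  rcases (AbsorbsAt.innerVisits_nonneg Q E Nature.L i).eq_or_lt with h0 | h0
  · simp [weight, ← h0]
  refine mul_le_mul_of_nonneg_right ?_ (AbsorbsAt.weight_nonneg Q E _ i s)
  obtain ⟨k, hk, hkm, rfl⟩ := h.exists_inner_label h0
  have hs0 := E.ratio_pos s
  by_cases hk1 : k = m - 1
  · have hsA : s ∉ A := fun hsA => hs ⟨by rw [hk1], hsA⟩
    calc Q.visitRatio E (lab k) * E.ratio s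
        ≤ Q.visitRatio E (lab (m - 1)) * ((1 - c) * E.ratioMax) := by
          rw [hk1]; exact mul_le_mul_of_nonneg_left (hgap s hsA) hRp.le
      _ = _ := by ring
  · have h2 := h.mono k (m - 2) hk (by omega) (by omega)
    calc Q.visitRatio E (lab k) * E.ratio s
        ≤ (1 - c) * Q.visitRatio E (lab (m - 1)) * E.ratioMax :=
          mul_le_mul (h2.trans hr) (E.ratio_le_ratioMax s) hs0.le (by positivity)
      _ = _ := by ring

/-- Absorption in the first state takes place almost always from the state above, upon a signal
with the smallest likelihood ratio. -/
theorem last_step_low (h : Q.IsOrdered E lab)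
    (hpos : 0 < Q.visitRatio E (lab 2)) {A : Set S} [DecidablePred (· ∈ A)] {Θ c : ℝ}
    (hΘ0 : 0 ≤ Θ) (hΘ1 : Θ ≤ 1) (hc : 0 ≤ c) (hc1 : c ≤ 1)
    (hv : Θ * Q.visits E Nature.H (lab 1) ≤
      Q.visitRatio E (lab 2) * E.ratioMin * Q.visits E Nature.L (lab 1))
    (hgap : ∀ s, s ∉ A → E.ratioMin ≤ (1 - c) * E.ratio s)
    (hr : Q.visitRatio E (lab 2) ≤ (1 - c) * Q.visitRatio E (lab 3))
    (h1 : Q.visitRatio E (lab 2) * E.ratioMin ≤ 1 - c) :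
    c * (Q.visits E Nature.H (lab 1) - ∑ s with s ∈ A,
        Q.weight E Nature.H (lab 2) s * Q.f (lab 2) s (lab 1)) ≤
        (1 - Θ) * Q.visits E Nature.H (lab 1) ∧
      Θ * c * (Q.visits E Nature.L (lab 1) - ∑ s with s ∈ A,
        Q.weight E Nature.L (lab 2) s * Q.f (lab 2) s (lab 1)) ≤
        (1 - Θ) * Q.visits E Nature.L (lab 1) := by
  have hl := E.ratioMin_pos
  have hc' : 0 ≤ 1 - c := sub_nonneg.2 hc1
  set B := Q.visitRatio E (lab 2) * E.ratioMin with hB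
  have hBp : 0 < B := mul_pos hpos hl
  -- The concentration lemma is applied with H and L exchanged; the upper bound for the L/H ratio is
  -- then `B⁻¹`.
  have conv : ∀ (d u v : ℝ), B * u ≤ d * v → u ≤ d * B⁻¹ * v := by
    intro d u v huv
    rw [mul_right_comm, ← div_eq_mul_inv, le_div_iff₀ hBp, mul_comm]
    exact huv
  refine h.absorbsAt.last_step_concentration (inv_pos.2 hBp) hc hΘ0 hΘ1 ?_ ?_ ?_ ?_
  · intro i s
    have := conv 1 _ _ ((h.le_weight_high (i₀ := 2)
      (fun k hk hkm _ => h.mono 2 k le_rfl hk hkm) i s).trans_eq (one_mul _).symm)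
    rwa [one_mul] at this
  · intro i s hs
    refine conv _ _ _ ?_
    rw [h.absorbsAt.weight_high, ← mul_assoc]
    rcases (AbsorbsAt.innerVisits_nonneg Q E Nature.L i).eq_or_lt with h0 | h0
    · simp [weight, ← h0]
    refine mul_le_mul_of_nonneg_right ?_ (AbsorbsAt.weight_nonneg Q E _ i s)
    obtain ⟨k, hk, hkm, rfl⟩ := h.exists_inner_label h0
    have hs0 := E.ratio_pos s
    by_cases hk1 : k = 2
    · have hsA : s ∉ A := fun hsA => hs ⟨by rw [hk1], hsA⟩
      calc B ≤ Q.visitRatio E (lab 2) * ((1 - c) * E.ratio s) :=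
            mul_le_mul_of_nonneg_left (hgap s hsA) hpos.le
        _ = _ := by rw [hk1]; ring
    · have h2 := h.mono 3 k (by omega) (by omega) hkm
      have h3 : Q.visitRatio E (lab 2) ≤ (1 - c) * Q.visitRatio E (lab k) :=
        hr.trans (mul_le_mul_of_nonneg_left h2 hc')
      calc B ≤ (1 - c) * Q.visitRatio E (lab k) * E.ratio s :=
            mul_le_mul h3 (E.ratioMin_le_ratio s) hl.le (hpos.le.trans h3)
        _ = _ := by ring
  · rw [← div_eq_mul_inv, le_div_iff₀ hBp, one_mul]
    exact h1
  · rw [mul_right_comm, ← div_eq_mul_inv, div_le_iff₀ hBp, mul_comm _ B]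
    exact hv

/-- If the likelihood ratios of the states next to a cut differ nearly by the factor `γ`, then the
flow across the cut is large compared to the flow of absorption, and hence so are the numbers of
visits to these two states. -/
theorem le_innerVisits_of_cut (h : Q.IsOrdered E lab) {k : ℕ} (hk : 2 ≤ k) (hkm : k + 1 < m)
    (hpos : 0 < Q.visitRatio E (lab 2)) {Θ c n₀ : ℝ} (hc : 0 < c) (hc1 : c ≤ 1)
    (hΘc : 1 - Θ ≤ c / 4) (hΘ1 : Θ ≤ 1)
    (hΘ : Θ * E.gamma * Q.visitRatio E (lab k) ≤ Q.visitRatio E (lab (k + 1)))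
    (hlow : ∀ i, 2 ≤ i → i < k → Q.visitRatio E (lab i) ≤ (1 - c) * Q.visitRatio E (lab k))
    (hhigh : ∀ i, k + 1 < i → i < m →
      Q.visitRatio E (lab (k + 1)) ≤ (1 - c) * Q.visitRatio E (lab i))
    {A B : Set S} [DecidablePred (· ∈ A)] [DecidablePred (· ∈ B)]
    (hA : ∀ s ∈ A, E.ratio s = E.ratioMin) (hB : ∀ s ∈ B, E.ratio s = E.ratioMax)
    (hnA : n₀ ≤ ∑ s with s ∈ A, Q.weight E Nature.L (lab 2) s * Q.f (lab 2) s (lab 1))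
    (hnB : n₀ ≤ ∑ s with s ∈ B,
      Q.weight E Nature.L (lab (m - 1)) s * Q.f (lab (m - 1)) s (lab m)) :
    (E.ratioMax - E.ratioMin) * n₀ ≤
        2 * E.ratioMax * (1 - Θ) * Q.innerVisits E Nature.L (lab k) ∧
      (E.ratioMax - E.ratioMin) * n₀ ≤
        2 * E.ratioMax * (1 - Θ) * Q.innerVisits E Nature.L (lab (k + 1)) := by
  have hA' := h.absorbsAt
  have hw := hA'.start_lt_one ((hA'.visitRatio_pos_iff _).1 hpos)
  have hl := E.ratioMin_pos
  have hL := E.ratioMax_pos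
  have hlL := E.ratioMin_lt_ratioMax
  have hRp := h.visitRatio_pos le_rfl hk (by omega) hpos
  have hRR := h.mono k (k + 1) hk (by omega) hkm
  have hr2 := h.mono 2 k le_rfl hk (by omega)
  have hrm := h.mono (k + 1) (m - 1) (by omega) (by omega) (by omega)
  have hΘ0 : 0 ≤ Θ := by linarith
  set C := lower lab k
  set R := Q.visitRatio E (lab k)
  set R' := Q.visitRatio E (lab (k + 1))
  have hR'p : 0 < R' := hRp.trans_le hRR
  have hΘ' : Θ * (R * E.ratioMax) ≤ R' * E.ratioMin := by
    rw [← E.gamma_mul_ratioMin]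
    have := mul_le_mul_of_nonneg_right hΘ hl.le
    linarith
  set F := Q.flow E (lab 1) (lab m) Nature.L C Cᶜ with hF
  have hF' : F = Q.flow E (lab 1) (lab m) Nature.L Cᶜ C := hA'.flow_balance hw _ _
  have hF0 : 0 ≤ F := AbsorbsAt.flow_nonneg hw _ _ _
  have key := hA'.cut_defect hw C (R * E.ratioMax) (R' * E.ratioMin)
  have hC0 : ∀ i ∈ C, ∀ s, 0 ≤ (R * E.ratioMax * Q.weight E Nature.L i s -
      Q.weight E Nature.H i s) * ∑ j ∈ Cᶜ, Q.restart (lab 1) (lab m) i s j := fun i hi s =>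
    mul_nonneg (hA'.defect_low_nonneg (h.visitRatio_le_of_mem_lower (by omega) hi) s)
      (AbsorbsAt.sum_restart_nonneg hw _ i s)
  have hD0 : ∀ i ∈ Cᶜ, ∀ s, 0 ≤ (Q.weight E Nature.H i s - R' * E.ratioMin *
      Q.weight E Nature.L i s) * ∑ j ∈ C, Q.restart (lab 1) (lab m) i s j := fun i hi s =>
    mul_nonneg (hA'.defect_high_nonneg (h.le_visitRatio_of_notMem_lower (by omega) (by omega)
      (Finset.mem_compl.1 hi)) s) (AbsorbsAt.sum_restart_nonneg hw _ i s)
  set X := ∑ i ∈ C, ∑ s, (R * E.ratioMax * Q.weight E Nature.L i s -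
      Q.weight E Nature.H i s) * ∑ j ∈ Cᶜ, Q.restart (lab 1) (lab m) i s j with hX
  set Y := ∑ i ∈ Cᶜ, ∑ s, (Q.weight E Nature.H i s - R' * E.ratioMin *
      Q.weight E Nature.L i s) * ∑ j ∈ C, Q.restart (lab 1) (lab m) i s j with hY
  have hX0 : 0 ≤ X := Finset.sum_nonneg fun i hi => Finset.sum_nonneg fun s _ => hC0 i hi s
  have hY0 : 0 ≤ Y := Finset.sum_nonneg fun i hi => Finset.sum_nonneg fun s _ => hD0 i hi s
  -- The total loss at the cut is a share of the flow of order `1 - Θ`, because the adjacent ratios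
  -- differ almost by the factor `γ`.
  have hXY : X + Y ≤ R * E.ratioMax * (1 - Θ) * F := by
    rw [key]
    exact mul_le_mul_of_nonneg_right (by linarith) hF0
  have m2 : lab 2 ∈ C := (h.mem_lower (by omega) (by omega) (by omega)).2 hk
  have mm : lab (m - 1) ∈ Cᶜ := Finset.mem_compl.2 fun hmem =>
    absurd ((h.mem_lower (by omega) (by omega) (by omega)).1 hmem) (by omega)
  have mk : lab k ∈ C := (h.mem_lower (by omega) (by omega) (by omega)).2 le_rfl
  have mk1 : lab (k + 1) ∈ Cᶜ := Finset.mem_compl.2 fun hmem =>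
    absurd ((h.mem_lower (by omega) (by omega) (by omega)).1 hmem) (by omega)
  -- restarts on the wrong side of the cut
  have hXlow : R * (E.ratioMax - E.ratioMin) * (n₀ * Q.startMass (lab 1) (lab m) Cᶜ) ≤ X := by
    have hG0 := AbsorbsAt.startMass_nonneg hw Cᶜ
    calc R * (E.ratioMax - E.ratioMin) * (n₀ * Q.startMass (lab 1) (lab m) Cᶜ)
        ≤ R * (E.ratioMax - E.ratioMin) * ((∑ s with s ∈ A, Q.weight E Nature.L (lab 2) s *
            Q.f (lab 2) s (lab 1)) * Q.startMass (lab 1) (lab m) Cᶜ) :=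
          mul_le_mul_of_nonneg_left (mul_le_mul_of_nonneg_right hnA hG0)
            (mul_nonneg hRp.le (by linarith))
      _ = ∑ s with s ∈ A, R * (E.ratioMax - E.ratioMin) * Q.weight E Nature.L (lab 2) s *
            (Q.f (lab 2) s (lab 1) * Q.startMass (lab 1) (lab m) Cᶜ) := by
          rw [Finset.sum_mul, Finset.mul_sum]
          exact Finset.sum_congr rfl fun s _ => by ring
      _ ≤ ∑ s with s ∈ A, (R * E.ratioMax * Q.weight E Nature.L (lab 2) s -
            Q.weight E Nature.H (lab 2) s) *
            ∑ j ∈ Cᶜ, Q.restart (lab 1) (lab m) (lab 2) s j := by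
          refine Finset.sum_le_sum fun s hs => ?_
          have hw0 := AbsorbsAt.weight_nonneg Q E Nature.L (lab 2) s
          refine mul_le_mul ?_ ?_ (mul_nonneg (Q.f_nonneg _ _ _) hG0) ?_
          -- An upward crossing on a lowest-ratio signal has H/L ratio at most `R * ratioMin`,
          -- whereas the cut allows `R * ratioMax`. The loss per unit of L-weight is at least the
          -- difference.
          · rw [hA'.weight_high, hA s (Finset.mem_filter.1 hs).2, ← sub_mul]
            refine mul_le_mul_of_nonneg_right ?_ hw0
            have := mul_le_mul_of_nonneg_right hr2 hl.le
            linarith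
          · refine le_trans (mul_le_mul_of_nonneg_right ?_ hG0)
              (AbsorbsAt.exit_mul_startMass_le _ _ _)
            exact le_add_of_nonneg_right (Q.f_nonneg _ _ _)
          · exact hA'.defect_low_nonneg (h.visitRatio_le_of_mem_lower (by omega) m2) s
      _ ≤ ∑ s, (R * E.ratioMax * Q.weight E Nature.L (lab 2) s -
            Q.weight E Nature.H (lab 2) s) *
            ∑ j ∈ Cᶜ, Q.restart (lab 1) (lab m) (lab 2) s j :=
          Finset.sum_le_sum_of_subset_of_nonneg (Finset.filter_subset _ _)
            fun s _ _ => hC0 _ m2 s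
      _ ≤ X := Finset.single_le_sum (f := fun i => ∑ s, (R * E.ratioMax *
            Q.weight E Nature.L i s - Q.weight E Nature.H i s) *
            ∑ j ∈ Cᶜ, Q.restart (lab 1) (lab m) i s j)
            (fun i hi => Finset.sum_nonneg fun s _ => hC0 i hi s) m2
  have hYlow : R * (E.ratioMax - E.ratioMin) * (n₀ * Q.startMass (lab 1) (lab m) C) ≤ Y := by
    have hG0 := AbsorbsAt.startMass_nonneg hw C
    calc R * (E.ratioMax - E.ratioMin) * (n₀ * Q.startMass (lab 1) (lab m) C)
        ≤ R * (E.ratioMax - E.ratioMin) * ((∑ s with s ∈ B, Q.weight E Nature.L (lab (m - 1)) s *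
            Q.f (lab (m - 1)) s (lab m)) * Q.startMass (lab 1) (lab m) C) :=
          mul_le_mul_of_nonneg_left (mul_le_mul_of_nonneg_right hnB hG0)
            (mul_nonneg hRp.le (by linarith))
      _ = ∑ s with s ∈ B, R * (E.ratioMax - E.ratioMin) * Q.weight E Nature.L (lab (m - 1)) s *
            (Q.f (lab (m - 1)) s (lab m) * Q.startMass (lab 1) (lab m) C) := by
          rw [Finset.sum_mul, Finset.mul_sum]
          exact Finset.sum_congr rfl fun s _ => by ring
      _ ≤ ∑ s with s ∈ B, (Q.weight E Nature.H (lab (m - 1)) s - R' * E.ratioMin *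
            Q.weight E Nature.L (lab (m - 1)) s) *
            ∑ j ∈ C, Q.restart (lab 1) (lab m) (lab (m - 1)) s j := by
          refine Finset.sum_le_sum fun s hs => ?_
          have hw0 := AbsorbsAt.weight_nonneg Q E Nature.L (lab (m - 1)) s
          refine mul_le_mul ?_ ?_ (mul_nonneg (Q.f_nonneg _ _ _) hG0) ?_
          · rw [hA'.weight_high, hB s (Finset.mem_filter.1 hs).2, ← sub_mul]
            refine mul_le_mul_of_nonneg_right ?_ hw0
            have e1 := mul_le_mul_of_nonneg_right hrm hL.le
            have e2 := mul_le_mul_of_nonneg_right hRR (sub_pos.2 hlL).le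
            linarith
          · refine le_trans (mul_le_mul_of_nonneg_right ?_ hG0)
              (AbsorbsAt.exit_mul_startMass_le _ _ _)
            exact le_add_of_nonneg_left (Q.f_nonneg _ _ _)
          · exact hA'.defect_high_nonneg (h.le_visitRatio_of_notMem_lower (by omega) (by omega)
              (Finset.mem_compl.1 mm)) s
      _ ≤ ∑ s, (Q.weight E Nature.H (lab (m - 1)) s - R' * E.ratioMin *
            Q.weight E Nature.L (lab (m - 1)) s) *
            ∑ j ∈ C, Q.restart (lab 1) (lab m) (lab (m - 1)) s j :=
          Finset.sum_le_sum_of_subset_of_nonneg (Finset.filter_subset _ _)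
            fun s _ _ => hD0 _ mm s
      _ ≤ Y := Finset.single_le_sum (f := fun i => ∑ s, (Q.weight E Nature.H i s -
            R' * E.ratioMin * Q.weight E Nature.L i s) *
            ∑ j ∈ C, Q.restart (lab 1) (lab m) i s j)
            (fun i hi => Finset.sum_nonneg fun s _ => hD0 i hi s) mm
  -- The start masses on the two sides of the cut add up to 1, so the two losses together do not
  -- depend on where the chain starts.
  have hFlow : (E.ratioMax - E.ratioMin) * n₀ ≤ E.ratioMax * (1 - Θ) * F := by
    refine le_of_mul_le_mul_left ?_ hRp
    have e := hA'.startMass_add_compl hw C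
    have e1 : R * ((E.ratioMax - E.ratioMin) * n₀) =
        R * (E.ratioMax - E.ratioMin) * (n₀ * Q.startMass (lab 1) (lab m) C) +
        R * (E.ratioMax - E.ratioMin) * (n₀ * Q.startMass (lab 1) (lab m) Cᶜ) := by
      linear_combination (-(R * (E.ratioMax - E.ratioMin) * n₀)) * e
    linarith
  -- flow from states that are not next to the cut
  have hXk : c * (R * E.ratioMax) * ∑ i ∈ C.erase (lab k), ∑ s, Q.weight E Nature.L i s *
      ∑ j ∈ Cᶜ, Q.restart (lab 1) (lab m) i s j ≤ X := by
    calc _ = ∑ i ∈ C.erase (lab k), ∑ s, c * (R * E.ratioMax) * Q.weight E Nature.L i s *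
          ∑ j ∈ Cᶜ, Q.restart (lab 1) (lab m) i s j := by
          simp only [Finset.mul_sum, mul_assoc]
      _ ≤ ∑ i ∈ C.erase (lab k), ∑ s, (R * E.ratioMax * Q.weight E Nature.L i s -
            Q.weight E Nature.H i s) * ∑ j ∈ Cᶜ, Q.restart (lab 1) (lab m) i s j := by
          refine Finset.sum_le_sum fun i hi => Finset.sum_le_sum fun s _ => ?_
          refine mul_le_mul_of_nonneg_right ?_ (AbsorbsAt.sum_restart_nonneg hw _ i s)
          obtain ⟨hik, hiC⟩ := Finset.mem_erase.1 hi
          rw [hA'.weight_high, ← sub_mul]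
          rcases (AbsorbsAt.innerVisits_nonneg Q E Nature.L i).eq_or_lt with h0 | h0
          · simp [weight, ← h0]
          refine mul_le_mul_of_nonneg_right ?_ (AbsorbsAt.weight_nonneg Q E _ i s)
          obtain ⟨j, hj, hjm, rfl⟩ := h.exists_inner_label h0
          have hjk : j ≤ k := (h.mem_lower (by omega) (by omega) (by omega)).1 hiC
          have hjk' : j ≠ k := by rintro rfl; exact hik rfl
          have := mul_le_mul (hlow j hj (by omega)) (E.ratio_le_ratioMax s) (E.ratio_pos s).le
            (mul_nonneg (sub_nonneg.2 hc1) hRp.le)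
          linarith
      _ ≤ X := Finset.sum_le_sum_of_subset_of_nonneg (Finset.erase_subset _ _)
          fun i hi _ => Finset.sum_nonneg fun s _ => hC0 i hi s
  have hYk : c * (R' * E.ratioMin) * ∑ i ∈ Cᶜ.erase (lab (k + 1)), ∑ s,
      Q.weight E Nature.L i s * ∑ j ∈ C, Q.restart (lab 1) (lab m) i s j ≤ Y := by
    calc _ = ∑ i ∈ Cᶜ.erase (lab (k + 1)), ∑ s, c * (R' * E.ratioMin) *
          Q.weight E Nature.L i s * ∑ j ∈ C, Q.restart (lab 1) (lab m) i s j := by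
          simp only [Finset.mul_sum, mul_assoc]
      _ ≤ ∑ i ∈ Cᶜ.erase (lab (k + 1)), ∑ s, (Q.weight E Nature.H i s - R' * E.ratioMin *
            Q.weight E Nature.L i s) * ∑ j ∈ C, Q.restart (lab 1) (lab m) i s j := by
          refine Finset.sum_le_sum fun i hi => Finset.sum_le_sum fun s _ => ?_
          refine mul_le_mul_of_nonneg_right ?_ (AbsorbsAt.sum_restart_nonneg hw _ i s)
          obtain ⟨hik, hiC⟩ := Finset.mem_erase.1 hi
          rw [hA'.weight_high, ← sub_mul]
          rcases (AbsorbsAt.innerVisits_nonneg Q E Nature.L i).eq_or_lt with h0 | h0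
          · simp [weight, ← h0]
          refine mul_le_mul_of_nonneg_right ?_ (AbsorbsAt.weight_nonneg Q E _ i s)
          obtain ⟨j, hj, hjm, rfl⟩ := h.exists_inner_label h0
          have hjk : ¬ j ≤ k := fun hjk => Finset.mem_compl.1 hiC
            ((h.mem_lower (by omega) (by omega) (by omega)).2 hjk)
          have hjk' : j ≠ k + 1 := by rintro rfl; exact hik rfl
          have e1 := hhigh j (by omega) hjm
          have e2 := h.mono (k + 1) j (by omega) (by omega) hjm
          have e3 := mul_le_mul_of_nonneg_left (E.ratioMin_le_ratio s)
            (AbsorbsAt.visitRatio_nonneg Q E (lab j))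
          have e4 := mul_le_mul_of_nonneg_right e1 hl.le
          have e5 := mul_le_mul_of_nonneg_left (mul_le_mul_of_nonneg_right e2 hl.le) hc.le
          linarith
      _ ≤ Y := Finset.sum_le_sum_of_subset_of_nonneg (Finset.erase_subset _ _)
          fun i hi _ => Finset.sum_nonneg fun s _ => hD0 i hi s
  have hRL : 0 < R * E.ratioMax := mul_pos hRp hL
  have fin : ∀ v, F ≤ 2 * v → (E.ratioMax - E.ratioMin) * n₀ ≤ 2 * E.ratioMax * (1 - Θ) * v := by
    intro v hv
    have := mul_le_mul_of_nonneg_left hv (mul_nonneg hL.le (sub_nonneg.2 hΘ1))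
    linarith
  -- States not next to the cut lose at least a fraction `c` of the bound, so they carry little of
  -- the flow. From below they carry at most a quarter; from above a factor `Θ ≥ 1 / 2` is lost,
  -- which leaves at most half. This is the reason for `c / 4`.
  constructor
  · refine fin _ (hA'.flow_le_of_single hw mk ?_)
    set Z := ∑ i ∈ C.erase (lab k), ∑ s, Q.weight E Nature.L i s *
      ∑ j ∈ Cᶜ, Q.restart (lab 1) (lab m) i s j
    have e1 : R * E.ratioMax * (c * Z) ≤ R * E.ratioMax * ((1 - Θ) * F) := by linarith
    have e2 := le_of_mul_le_mul_left e1 hRL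
    have e3 := mul_le_mul_of_nonneg_right hΘc hF0
    have e4 : c * Z ≤ c * (F / 4) := by linarith
    have e5 := le_of_mul_le_mul_left e4 hc
    rw [← hF]; linarith
  · refine fin _ (hF' ▸ hA'.flow_le_of_single hw mk1 ?_)
    rw [← hF']
    set Z := ∑ i ∈ Cᶜ.erase (lab (k + 1)), ∑ s, Q.weight E Nature.L i s *
      ∑ j ∈ C, Q.restart (lab 1) (lab m) i s j
    have hZ0 : 0 ≤ Z := Finset.sum_nonneg fun i _ => Finset.sum_nonneg fun s _ =>
      mul_nonneg (AbsorbsAt.weight_nonneg Q E _ i s) (AbsorbsAt.sum_restart_nonneg hw _ i s)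
    have e0 := mul_le_mul_of_nonneg_left hΘ' (mul_nonneg hc.le hZ0)
    have e1 : R * E.ratioMax * (c * (Θ * Z)) ≤ R * E.ratioMax * ((1 - Θ) * F) := by linarith
    have e2 := le_of_mul_le_mul_left e1 hRL
    have e3 := mul_le_mul_of_nonneg_right hΘc hF0
    have e4 : c * (Θ * Z) ≤ c * (F / 4) := by linarith
    have e5 := le_of_mul_le_mul_left e4 hc
    have e6 : 1 / 2 * Z ≤ Θ * Z := mul_le_mul_of_nonneg_right (by linarith) hZ0
    linarith

end IsOrdered

end Protocol

/-! ### Ladder protocols and the lower bound on the supremum -/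

namespace Protocol

variable {S : Type*} {m : ℕ}

/-- Each visit to `k` lowers the expected value of `w` by the fixed amount `δ k`. Since `w` is
nonnegative, at most `w k / δ k` visits are expected. -/
theorem isTransient_of_superharmonic [Fintype S] {E : Environment S} {Q : Protocol S m}
    {θ : Nature} (w : Fin m → ℝ) (hw : ∀ i, 0 ≤ w i)
    (hsuper : ∀ i, ∑ j, Q.trans E θ i j * w j ≤ w i) {k : Fin m}
    (hk : ∑ j, Q.trans E θ k j * w j < w k) : Q.IsTransient E θ k := by
  set δ : Fin m → ℝ := fun i => w i - ∑ j, Q.trans E θ i j * w j with hδ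
  have hδ0 : ∀ i, 0 ≤ δ i := fun i => sub_nonneg.2 (hsuper i)
  have hδk : 0 < δ k := sub_pos.2 hk
  have hstep : ∀ t, ∑ i, (Q.trans E θ ^ t) k i * δ i =
      ∑ i, (Q.trans E θ ^ t) k i * w i - ∑ i, (Q.trans E θ ^ (t + 1)) k i * w i := by
    intro t
    have h1 : ∑ i, (Q.trans E θ ^ (t + 1)) k i * w i =
        ∑ i, (Q.trans E θ ^ t) k i * ∑ j, Q.trans E θ i j * w j := by
      simp only [pow_succ, Matrix.mul_apply, Finset.sum_mul, Finset.mul_sum, mul_assoc]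
      exact Finset.sum_comm
    rw [h1, ← Finset.sum_sub_distrib]
    exact Finset.sum_congr rfl fun i _ => by rw [hδ]; ring
  have hsum : ∀ T, ∑ t ∈ Finset.range T, ∑ i, (Q.trans E θ ^ t) k i * δ i ≤ w k := by
    intro T
    simp only [hstep]
    rw [Finset.sum_range_sub']
    have h2 : ∑ i, (Q.trans E θ ^ 0) k i * w i = w k := by simp [Matrix.one_apply]
    rw [h2]
    exact sub_le_self _ (Finset.sum_nonneg fun i _ => mul_nonneg (Q.pow_nonneg E θ T k i) (hw i))
  refine summable_of_sum_range_le (c := w k / δ k) (fun t => Q.pow_nonneg E θ t k k) fun T => ?_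
  rw [le_div_iff₀ hδk, Finset.sum_mul]
  refine le_trans (Finset.sum_le_sum fun t _ => ?_) (hsum T)
  exact Finset.single_le_sum (f := fun i => (Q.trans E θ ^ t) k i * δ i)
    (fun i _ => mul_nonneg (Q.pow_nonneg E θ t k i) (hδ0 i)) (Finset.mem_univ k)

/-- The next memory state of the ladder. -/
def above (i : Fin m) : Fin m := ⟨min (i + 1) (m - 1), by have := i.2; omega⟩

/-- The previous memory state of the ladder. -/
def below (i : Fin m) : Fin m := ⟨i - 1, by have := i.2; omega⟩

/-- Probability of moving up upon the favourable signal. -/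
def upRate (β : ℝ) (i : Fin m) : ℝ :=
  if (i : ℕ) = 0 ∨ (i : ℕ) = m - 1 then 0 else if (i : ℕ) = m - 2 then β else 1

/-- Probability of moving down upon the unfavourable signal. -/
def downRate (α : ℝ) (i : Fin m) : ℝ :=
  if (i : ℕ) = 0 ∨ (i : ℕ) = m - 1 then 0 else if (i : ℕ) = 1 then α else 1

theorem upRate_mem {β : ℝ} (hβ : 0 < β) (hβ1 : β ≤ 1) (i : Fin m) :
    0 ≤ upRate β i ∧ upRate β i ≤ 1 := by
  unfold upRate
  split_ifs <;> constructor <;> linarith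

theorem downRate_mem {α : ℝ} (hα : 0 < α) (hα1 : α ≤ 1) (i : Fin m) :
    0 ≤ downRate α i ∧ downRate α i ≤ 1 := by
  unfold downRate
  split_ifs <;> constructor <;> linarith

open Classical in
/-- The ladder protocol: it starts in the lowest transient state, moves one step up upon the signal
`s₁` and one step down upon the signal `s₀`, and enters the two absorbing states at the ends only
with probability `α` and `β`. -/
def ladder (hm : 4 ≤ m) (s₀ s₁ : S) (hs : s₀ ≠ s₁) {α β : ℝ} (hα : 0 < α) (hα1 : α ≤ 1)
    (hβ : 0 < β) (hβ1 : β ≤ 1) : Protocol S m where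
  f i s j := if s = s₁ then
      (1 - upRate β i) * (if j = i then 1 else 0) + upRate β i * (if j = above i then 1 else 0)
    else if s = s₀ then
      (1 - downRate α i) * (if j = i then 1 else 0) +
        downRate α i * (if j = below i then 1 else 0)
    else if j = i then 1 else 0
  f_nonneg i s j := by
    have h1 := upRate_mem hβ hβ1 i
    have h2 := downRate_mem hα hα1 i
    have h3 : ∀ k : Fin m, (0 : ℝ) ≤ if j = k then 1 else 0 := fun k => by split_ifs <;> norm_num
    by_cases ha : s = s₁
    · rw [if_pos ha]
      exact add_nonneg (mul_nonneg (sub_nonneg.2 h1.2) (h3 _)) (mul_nonneg h1.1 (h3 _))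
    rw [if_neg ha]
    by_cases hb : s = s₀
    · rw [if_pos hb]
      exact add_nonneg (mul_nonneg (sub_nonneg.2 h2.2) (h3 _)) (mul_nonneg h2.1 (h3 _))
    · rw [if_neg hb]
      exact h3 _
  f_sum i s := by
    by_cases ha : s = s₁
    · simp [ha, Finset.sum_add_distrib]
    · by_cases hb : s = s₀
      · simp [hb, hs, Finset.sum_add_distrib]
      · simp [ha, hb]
  g j := if j = ⟨1, by omega⟩ then 1 else 0
  g_nonneg j := by split_ifs <;> norm_num
  g_sum := by simp
  a j := if j = ⟨m - 1, by omega⟩ then 1 else 0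
  a_nonneg j := by split_ifs <;> norm_num
  a_le_one j := by split_ifs <;> norm_num

section Ladder

variable (hm : 4 ≤ m) {s₀ s₁ : S} (hs : s₀ ≠ s₁) {α β : ℝ} (hα : 0 < α) (hα1 : α ≤ 1)
  (hβ : 0 < β) (hβ1 : β ≤ 1)

theorem ladder_isAbsorbing {i : Fin m} (hi : (i : ℕ) = 0 ∨ (i : ℕ) = m - 1) :
    (ladder hm s₀ s₁ hs hα hα1 hβ hβ1).IsAbsorbing i := by
  intro s
  have h1 : upRate β i = 0 := by simp [upRate, hi]
  have h2 : downRate α i = 0 := by simp [downRate, hi]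
  simp [ladder, h1, h2]

variable [Fintype S] (E : Environment S)

theorem ladder_trans_sum (θ : Nature) (φ : Fin m → ℝ) (i : Fin m) :
    ∑ j, (ladder hm s₀ s₁ hs hα hα1 hβ hβ1).trans E θ i j * φ j =
      φ i + E.sig θ s₁ * upRate β i * (φ (above i) - φ i) +
        E.sig θ s₀ * downRate α i * (φ (below i) - φ i) := by
  classical
  have h1 : ∀ s, ∑ j, (ladder hm s₀ s₁ hs hα hα1 hβ hβ1).f i s j * φ j = φ i +
      (if s = s₁ then upRate β i * (φ (above i) - φ i) else 0) +
      (if s = s₀ then downRate α i * (φ (below i) - φ i) else 0) := by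
    intro s
    by_cases ha : s = s₁
    · subst ha
      simp [ladder, Ne.symm hs, add_mul, Finset.sum_add_distrib]
      ring
    · by_cases hb : s = s₀
      · subst hb
        simp [ladder, hs, add_mul, Finset.sum_add_distrib]
        ring
      · simp [ladder, ha, hb]
  have h2 : ∑ j, (ladder hm s₀ s₁ hs hα hα1 hβ hβ1).trans E θ i j * φ j =
      ∑ s, E.sig θ s * ∑ j, (ladder hm s₀ s₁ hs hα hα1 hβ hβ1).f i s j * φ j := by
    simp only [trans_apply, Finset.sum_mul, Finset.mul_sum, mul_assoc]
    exact Finset.sum_comm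
  rw [h2]
  simp only [h1, mul_add, Finset.sum_add_distrib, ← Finset.sum_mul, E.sig_sum, mul_ite, mul_zero,
    Finset.sum_ite_eq', Finset.mem_univ, if_true, one_mul, mul_assoc]

theorem ladder_isTransient {i : Fin m} (h0 : (i : ℕ) ≠ 0) (h1 : (i : ℕ) ≠ m - 1) (θ : Nature) :
    (ladder hm s₀ s₁ hs hα hα1 hβ hβ1).IsTransient E θ i := by
  have hp := E.sig_pos θ s₁
  have hq := E.sig_pos θ s₀
  -- `B` is so large that the gain of `B ^ j` from moving up outweighs the loss from moving down,
  -- even at the lowest up rate `β`. Thus `B ^ m - B ^ j` is strictly superharmonic inside the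
  -- ladder.
  set B : ℝ := 1 + E.sig θ s₀ / (E.sig θ s₁ * β) with hB
  have hpβ : 0 < E.sig θ s₁ * β := mul_pos hp hβ
  have hB1 : 1 < B := by
    have := div_pos hq hpβ
    linarith
  have hBq : E.sig θ s₀ < E.sig θ s₁ * β * B := by
    rw [hB, mul_add, mul_div_cancel₀ _ hpβ.ne']
    linarith
  have step : ∀ k : Fin m, (k : ℕ) ≠ 0 → (k : ℕ) ≠ m - 1 →
      ∑ j, (ladder hm s₀ s₁ hs hα hα1 hβ hβ1).trans E θ k j * (B ^ m - B ^ (j : ℕ)) <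
        B ^ m - B ^ (k : ℕ) := by
    intro k hk0 hk1
    have hkm := k.2
    rw [ladder_trans_sum hm hs hα hα1 hβ hβ1 E θ (fun j => B ^ m - B ^ (j : ℕ)) k]
    have e1 : ((above k : Fin m) : ℕ) = (k - 1 : ℕ) + 2 := by simp only [above]; omega
    have e2 : ((below k : Fin m) : ℕ) = (k - 1 : ℕ) := rfl
    have e3 : (k : ℕ) = (k - 1 : ℕ) + 1 := by omega
    rw [e1, e2]
    set n := (k - 1 : ℕ)
    rw [e3]
    have hu : β ≤ upRate β k := by
      rw [upRate, if_neg (by simp [hk0, hk1])]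
      split_ifs
      exacts [le_rfl, hβ1]
    have hd := downRate_mem hα hα1 k
    have hBn : 0 < B ^ n := pow_pos (by linarith) n
    have e4 : E.sig θ s₀ * downRate α k < E.sig θ s₁ * upRate β k * B := by
      calc E.sig θ s₀ * downRate α k ≤ E.sig θ s₀ := mul_le_of_le_one_right hq.le hd.2
        _ < E.sig θ s₁ * β * B := hBq
        _ ≤ _ := by gcongr
    have e5 := mul_pos (mul_pos hBn (sub_pos.2 hB1)) (sub_pos.2 e4)
    rw [show B ^ (n + 2) = B ^ n * B * B by ring, pow_succ]
    linarith
  refine isTransient_of_superharmonic (fun j => B ^ m - B ^ (j : ℕ)) ?_ ?_ (step i h0 h1)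
  · intro j
    exact sub_nonneg.2 (pow_le_pow_right₀ hB1.le j.2.le)
  · intro j
    by_cases hj : (j : ℕ) = 0 ∨ (j : ℕ) = m - 1
    · have e1 : upRate β j = 0 := by simp [upRate, hj]
      have e2 : downRate α j = 0 := by simp [downRate, hj]
      rw [ladder_trans_sum hm hs hα hα1 hβ hβ1 E θ (fun j => B ^ m - B ^ (j : ℕ)) j]
      simp [e1, e2]
    · push Not at hj
      exact (step j hj.1 hj.2).le

theorem ladder_absorbsAt : (ladder hm s₀ s₁ hs hα hα1 hβ hβ1).AbsorbsAt E ⟨0, by omega⟩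
    ⟨m - 1, by omega⟩ where
  ne := by simp only [ne_eq, Fin.mk.injEq]; omega
  left := ladder_isAbsorbing hm hs hα hα1 hβ hβ1 (Or.inl rfl)
  right := ladder_isAbsorbing hm hs hα hα1 hβ hβ1 (Or.inr rfl)
  transient i h0 h1 θ := ladder_isTransient hm hs hα hα1 hβ hβ1 E
    (fun h => h0 (Fin.ext h)) (fun h => h1 (Fin.ext h)) θ

/-- Probability of absorption at the top of the ladder; `ρ` is the ratio of the probabilities of
the unfavourable and the favourable signal. -/
def ladderProb (m : ℕ) (α β ρ : ℝ) : ℝ :=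
  β / (β + α * ρ ^ (m - 2) + α * β * ρ * ∑ k ∈ Finset.range (m - 3), ρ ^ k)

theorem ladder_visits (θ : Nature) :
    (ladder hm s₀ s₁ hs hα hα1 hβ hβ1).visits E θ ⟨m - 1, by omega⟩ =
      ladderProb m α β (E.sig θ s₀ / E.sig θ s₁) := by
  have hp := E.sig_pos θ s₁
  have hq := E.sig_pos θ s₀
  set ρ := E.sig θ s₀ / E.sig θ s₁ with hρ
  have hρ0 : 0 < ρ := div_pos hq hp
  have hqp : E.sig θ s₀ = ρ * E.sig θ s₁ := (div_mul_cancel₀ _ hp.ne').symm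
  set c := ladderProb m α β ρ with hc
  have hden : 0 < β + α * ρ ^ (m - 2) + α * β * ρ * ∑ k ∈ Finset.range (m - 3), ρ ^ k := by
    have h1 : 0 ≤ ∑ k ∈ Finset.range (m - 3), ρ ^ k :=
      Finset.sum_nonneg fun k _ => (pow_pos hρ0 k).le
    have h2 := mul_pos hα (pow_pos hρ0 (m - 2))
    have h3 := mul_nonneg (mul_pos (mul_pos hα hβ) hρ0).le h1
    linarith
  have hceq : c * (β + α * ρ ^ (m - 2) + α * β * ρ * ∑ k ∈ Finset.range (m - 3), ρ ^ k) = β :=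
    div_mul_cancel₀ _ hden.ne'
  -- As in gambler's ruin, the increments of a harmonic function are geometric with ratio `ρ`. The
  -- exit rate `α` fixes the first increment, and `hceq` is the harmonic condition at the top inner
  -- state.
  set ψ : ℕ → ℝ := fun i => c * (1 + α * ρ * ∑ k ∈ Finset.range (i - 1), ρ ^ k) with hψ
  set u : Fin m → ℝ := fun i => if (i : ℕ) = 0 then 0 else if (i : ℕ) = m - 1 then 1 else ψ i
    with hu
  rw [(ladder_absorbsAt hm hs hα hα1 hβ hβ1 E).visits_right_eq_of_harmonic θ u]
  · have h1 : u ⟨1, by omega⟩ = c := by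
      simp only [hu, hψ]
      rw [if_neg (by omega), if_neg (by omega)]
      rw [Finset.sum_range_zero, mul_zero, add_zero, mul_one]
    simp only [ladder, ite_mul, one_mul, zero_mul, Finset.sum_ite_eq', Finset.mem_univ, if_true]
    exact h1
  · simp [hu]
  · simp only [hu]
    rw [if_neg (by omega), if_pos trivial]
  · intro i h0 h1
    have h0' : (i : ℕ) ≠ 0 := fun h => h0 (Fin.ext h)
    have h1' : (i : ℕ) ≠ m - 1 := fun h => h1 (Fin.ext h)
    have him := i.2
    rw [ladder_trans_sum]
    have e1 : ((above i : Fin m) : ℕ) = (i : ℕ) + 1 := by simp only [above]; omega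
    have e2 : ((below i : Fin m) : ℕ) = (i - 1 : ℕ) := rfl
    obtain ⟨n, hn⟩ : ∃ n, (i : ℕ) = n + 1 := ⟨i - 1, by omega⟩
    have ui : u i = c * (1 + α * ρ * ∑ k ∈ Finset.range n, ρ ^ k) := by
      simp only [hu, hψ]
      rw [if_neg h0', if_neg h1', hn, Nat.add_sub_cancel]
    have up : upRate β i * (u (above i) - u i) = c * α * ρ ^ (n + 1) := by
      by_cases htop : (i : ℕ) = m - 2
      · have ua : u (above i) = 1 := by
          simp only [hu, e1]
          rw [if_neg (by omega), if_pos (by omega)]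
        rw [upRate, if_neg (by simp [h0', h1']), if_pos htop, ua, ui]
        have e3 : n + 1 = m - 2 := by omega
        have e4 : n = m - 3 := by omega
        rw [e3, e4]
        linear_combination (-1 : ℝ) * hceq
      · have ua : u (above i) = c * (1 + α * ρ * ∑ k ∈ Finset.range (n + 1), ρ ^ k) := by
          simp only [hu, hψ, e1]
          rw [if_neg (by omega), if_neg (by omega), hn, Nat.add_sub_cancel]
        rw [upRate, if_neg (by simp [h0', h1']), if_neg htop, ua, ui, Finset.sum_range_succ,
          pow_succ]
        ring
    have down : downRate α i * (u (below i) - u i) = - (c * α * ρ ^ n) := by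
      by_cases hbot : (i : ℕ) = 1
      · have ub : u (below i) = 0 := by
          simp only [hu, e2]
          rw [if_pos (by omega)]
        have hn0 : n = 0 := by omega
        rw [downRate, if_neg (by simp [h0', h1']), if_pos hbot, ub, ui, hn0]
        simp
        ring
      · obtain ⟨l, rfl⟩ : ∃ l, n = l + 1 := ⟨n - 1, by omega⟩
        have ub : u (below i) = c * (1 + α * ρ * ∑ k ∈ Finset.range l, ρ ^ k) := by
          simp only [hu, hψ, e2]
          rw [if_neg (by omega), if_neg (by omega), hn]
          rfl
        rw [downRate, if_neg (by simp [h0', h1']), if_neg hbot, ub, ui, Finset.sum_range_succ,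
          pow_succ]
        ring
    rw [mul_assoc, mul_assoc, up, down, hqp]
    ring

theorem ladder_receiverValue :
    (ladder hm s₀ s₁ hs hα hα1 hβ hβ1).receiverValue E =
      E.prior * ladderProb m α β (E.sig Nature.H s₀ / E.sig Nature.H s₁) +
        (1 - E.prior) * (1 - ladderProb m α β (E.sig Nature.L s₀ / E.sig Nature.L s₁)) := by
  rw [(ladder_absorbsAt hm hs hα hα1 hβ hβ1 E).receiverValue_eq, ladder_visits, ladder_visits]
  · simp [ladder]
  · intro i hi
    simp [ladder, hi]

end Ladder

/-- Ladder protocols with small exit probabilities attain in the limit any pair of success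
probabilities whose odds have the maximal spread. -/
theorem le_iSup_receiverValue [Fintype S] (E : Environment S) (hm : 4 ≤ m) {e₁ e₂ : ℝ}
    (he₂ : 0 < e₂) (he₂1 : e₂ < 1)
    (he : (1 - e₁) * (1 - e₂) = E.gamma ^ (m - 2) * (e₁ * e₂)) :
    E.prior * (1 - e₁) + (1 - E.prior) * (1 - e₂) ≤ ⨆ R : Protocol S m, R.receiverValue E := by
  obtain ⟨s₁, hs₁⟩ := E.exists_ratio_eq_ratioMax
  obtain ⟨s₀, hs₀⟩ := E.exists_ratio_eq_ratioMin
  have hs : s₀ ≠ s₁ := by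
    rintro rfl
    exact E.ratioMin_lt_ratioMax.ne (hs₀.symm.trans hs₁)
  set ρ : Nature → ℝ := fun θ => E.sig θ s₀ / E.sig θ s₁ with hρ
  have hρ0 : ∀ θ, 0 < ρ θ := fun θ => div_pos (E.sig_pos θ s₀) (E.sig_pos θ s₁)
  have hρL : ρ Nature.L = E.gamma * ρ Nature.H := by
    have h1 := E.sig_pos Nature.L s₀
    have h2 := E.sig_pos Nature.L s₁
    have h3 := E.sig_pos Nature.H s₀
    have h4 := E.sig_pos Nature.H s₁
    simp only [hρ, Environment.gamma, ← hs₁, ← hs₀, Environment.ratio]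
    field_simp
  -- With exit rates `ε * a` and `ε * b`, the last term in the denominator of `ladderProb` is of
  -- second order in `ε`. The ratio of `a` to `b` is tuned so that the limit under L is `e₂`; `he`
  -- then makes it `1 - e₁` under H.
  set b := ρ Nature.L ^ (m - 2) * e₂ with hb
  set a := 1 - e₂ with ha
  have hb0 : 0 < b := mul_pos (pow_pos (hρ0 _) _) he₂
  have ha0 : 0 < a := sub_pos.2 he₂1
  have hlim : ∀ θ, Tendsto (fun ε : ℝ => ladderProb m (ε * a) (ε * b) (ρ θ)) (𝓝[>] 0)
      (𝓝 (b / (b + a * ρ θ ^ (m - 2)))) := by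
    intro θ
    have hden : 0 < b + a * ρ θ ^ (m - 2) := by have := hρ0 θ; positivity
    have h1 : Tendsto (fun ε : ℝ => b / (b + a * ρ θ ^ (m - 2) +
        ε * (a * b * ρ θ * ∑ k ∈ Finset.range (m - 3), ρ θ ^ k))) (𝓝 0)
        (𝓝 (b / (b + a * ρ θ ^ (m - 2) +
        0 * (a * b * ρ θ * ∑ k ∈ Finset.range (m - 3), ρ θ ^ k)))) := by
      refine Tendsto.div tendsto_const_nhds (Continuous.tendsto (by fun_prop) 0) ?_
      rw [zero_mul, add_zero]
      exact hden.ne'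
    rw [zero_mul, add_zero] at h1
    refine (h1.mono_left nhdsWithin_le_nhds).congr' ?_
    filter_upwards [self_mem_nhdsWithin] with ε hε
    have hε : ε ≠ 0 := ne_of_gt hε
    rw [ladderProb, ← mul_div_mul_left _ _ hε]
    congr 1
    ring
  have hH : b / (b + a * ρ Nature.H ^ (m - 2)) = 1 - e₁ := by
    have h1 : ρ Nature.L ^ (m - 2) = E.gamma ^ (m - 2) * ρ Nature.H ^ (m - 2) := by
      rw [hρL, mul_pow]
    have h2 := hρ0 Nature.H
    rw [div_eq_iff (by positivity), hb, ha, h1]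
    linear_combination (-(ρ Nature.H ^ (m - 2))) * he
  have hL : b / (b + a * ρ Nature.L ^ (m - 2)) = e₂ := by
    have h2 := hρ0 Nature.L
    rw [div_eq_iff (by positivity), hb, ha]
    ring
  have h1 := (tendsto_const_nhds (x := E.prior)).mul (hlim Nature.H) |>.add
    ((tendsto_const_nhds (x := 1 - E.prior)).mul
      ((tendsto_const_nhds (x := (1 : ℝ))).sub (hlim Nature.L)))
  rw [hH, hL] at h1
  refine le_of_tendsto h1 ?_
  have hsmall : ∀ d : ℝ, ∀ᶠ ε : ℝ in 𝓝[>] 0, ε * d ≤ 1 := by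
    intro d
    have : Tendsto (fun ε : ℝ => ε * d) (𝓝 0) (𝓝 (0 * d)) := Continuous.tendsto (by fun_prop) 0
    rw [zero_mul] at this
    exact ((this.mono_left nhdsWithin_le_nhds).eventually_lt_const one_pos).mono fun _ => le_of_lt
  filter_upwards [self_mem_nhdsWithin, hsmall a, hsmall b] with ε hε h2 h3
  have hε : 0 < ε := hε
  rw [← ladder_receiverValue hm hs (mul_pos hε ha0) h2 (mul_pos hε hb0) h3 E]
  exact le_ciSup (bddAbove_receiverValue E) _

end Protocol

/-! ### Optimal error probabilities under the odds constraint -/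

/-- The success probabilities `1 - e₁` and `1 - e₂` that maximize `p (1 - e₁) + (1 - p) (1 - e₂)`
subject to a bound `G` on the product of the odds. -/
theorem exists_optimal_errors {p G : ℝ} (hp : 0 < p) (hp1 : p < 1) (hG : 1 < G)
    (h1 : p / (1 - p) < G) (h2 : (1 - p) / p < G) :
    ∃ e₁ e₂ : ℝ, 0 < e₁ ∧ e₁ < 1 ∧ 0 < e₂ ∧ e₂ < 1 ∧ (1 - e₁) * (1 - e₂) = G * (e₁ * e₂) ∧
      p * ((G - 1) * e₁ + 1) = (1 - p) * ((G - 1) * e₂ + 1) := by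
  have hq : 0 < 1 - p := sub_pos.2 hp1
  have hK : 0 < G - 1 := sub_pos.2 hG
  have h0 : 0 < p * (1 - p) * G := mul_pos (mul_pos hp hq) (by linarith)
  -- The constraint factors as `((G - 1) * e₁ + 1) * ((G - 1) * e₂ + 1) = G`. Weighted by `p` and `1
  -- - p`, the factors have product `c * c`, and their sum is least when both equal `c`. The
  -- hypotheses on `G` keep the solution inside `(0, 1)`.
  set c := Real.sqrt (p * (1 - p) * G)
  have hc : c * c = p * (1 - p) * G := Real.mul_self_sqrt h0.le
  have hc0 : 0 < c := Real.sqrt_pos.2 h0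
  rw [div_lt_iff₀ hq] at h1
  rw [div_lt_iff₀ hp] at h2
  have k1 : p < c := by nlinarith
  have k2 : 1 - p < c := by nlinarith
  have k3 : c < G * p := by
    refine lt_of_mul_self_lt_mul_self₀ (by positivity) ?_
    have := mul_lt_mul_of_pos_right h2 (mul_pos (zero_lt_one.trans hG) hp)
    linarith
  have k4 : c < G * (1 - p) := by
    refine lt_of_mul_self_lt_mul_self₀ (by positivity) ?_
    have := mul_lt_mul_of_pos_right h1 (mul_pos (zero_lt_one.trans hG) hq)
    linarith
  have e1 : (G - 1) * ((c / p - 1) / (G - 1)) = c / p - 1 := mul_div_cancel₀ _ hK.ne'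
  have e2 : (G - 1) * ((c / (1 - p) - 1) / (G - 1)) = c / (1 - p) - 1 := mul_div_cancel₀ _ hK.ne'
  refine ⟨(c / p - 1) / (G - 1), (c / (1 - p) - 1) / (G - 1), ?_, ?_, ?_, ?_, ?_, ?_⟩
  · exact div_pos (sub_pos.2 ((one_lt_div hp).2 k1)) hK
  · rw [div_lt_one hK]
    exact sub_lt_sub_right ((div_lt_iff₀ hp).2 k3) 1
  · exact div_pos (sub_pos.2 ((one_lt_div hq).2 k2)) hK
  · rw [div_lt_one hK]
    exact sub_lt_sub_right ((div_lt_iff₀ hq).2 k4) 1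
  · set u := (c / p - 1) / (G - 1)
    set v := (c / (1 - p) - 1) / (G - 1)
    have h3 : ((G - 1) * u + 1) * ((G - 1) * v + 1) = G := by
      rw [e1, e2]
      field_simp
      linarith
    refine mul_left_cancel₀ hK.ne' ?_
    linear_combination (-1 : ℝ) * h3
  · rw [e1, e2]
    field_simp
    ring

/-- Success probabilities that are asymptotically optimal under a bound on the product of the odds
converge to the optimal ones. -/
theorem tendsto_of_asymptotically_optimal {p G e₁ e₂ V : ℝ} (hp : 0 < p) (hp1 : p < 1)
    (hG : 1 < G) (he₁ : 0 < e₁) (he : (1 - e₁) * (1 - e₂) = G * (e₁ * e₂))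
    (hbal : p * ((G - 1) * e₁ + 1) = (1 - p) * ((G - 1) * e₂ + 1)) {a b : ℕ → ℝ}
    (ha : ∀ n, a n ≤ 1) (hb : ∀ n, 0 ≤ b n)
    (hodds : ∀ n, a n * (1 - b n) ≤ G * (b n * (1 - a n)))
    (hlim : Tendsto (fun n => p * a n + (1 - p) * (1 - b n)) atTop (𝓝 V))
    (hV : p * (1 - e₁) + (1 - p) * (1 - e₂) ≤ V) :
    Tendsto a atTop (𝓝 (1 - e₁)) ∧ Tendsto b atTop (𝓝 e₂) := by
  have hq : 0 < 1 - p := sub_pos.2 hp1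
  have hK : 0 < G - 1 := sub_pos.2 hG
  set c := p * ((G - 1) * e₁ + 1) with hc
  have hc0 : 0 < c := by positivity
  have hcc : c * c = p * (1 - p) * G := by
    calc c * c = (p * ((G - 1) * e₁ + 1)) * ((1 - p) * ((G - 1) * e₂ + 1)) := by rw [← hbal]
      _ = _ := by linear_combination (-(p * (1 - p) * (G - 1))) * he
  -- In these variables the odds bound reads `c * c ≤ A n * B n`, and the payoff is a decreasing
  -- affine function of `A n + B n`.
  set A : ℕ → ℝ := fun n => p * ((G - 1) * (1 - a n) + 1) with hA
  set B : ℕ → ℝ := fun n => (1 - p) * ((G - 1) * b n + 1) with hB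
  have hAB : ∀ n, c * c ≤ A n * B n := by
    intro n
    have h1 : 0 ≤ p * (1 - p) * (G - 1) * (G * (b n * (1 - a n)) - a n * (1 - b n)) :=
      mul_nonneg (by positivity) (sub_nonneg.2 (hodds n))
    rw [hcc]
    simp only [hA, hB]
    linarith
  have hA0 : ∀ n, 0 < A n := fun n => by
    have := sub_nonneg.2 (ha n)
    simp only [hA]
    positivity
  have hB0 : ∀ n, 0 < B n := fun n => by
    have := hb n
    simp only [hB]
    positivity
  have hsum : Tendsto (fun n => A n + B n) atTop (𝓝 ((G - 1) * (1 - V) + 1)) := by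
    have := ((tendsto_const_nhds (x := (1 : ℝ))).sub hlim).const_mul (G - 1) |>.add
      (tendsto_const_nhds (x := (1 : ℝ)))
    refine this.congr fun n => ?_
    simp only [hA, hB]
    ring
  set s := (G - 1) * (1 - V) + 1
  have hs : s ≤ 2 * c := by
    have := mul_le_mul_of_nonneg_left hV hK.le
    have e : 2 * c = p * ((G - 1) * e₁ + 1) + (1 - p) * ((G - 1) * e₂ + 1) := by
      rw [← hbal]; ring
    rw [e]
    simp only [s]
    linarith
  have hs0 : 0 ≤ s := ge_of_tendsto' hsum fun n => (add_pos (hA0 n) (hB0 n)).le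
  have hsq : Tendsto (fun n => (A n + B n) * (A n + B n) - 4 * (c * c)) atTop
      (𝓝 (s * s - 4 * (c * c))) := (hsum.mul hsum).sub_const _
  -- The inequality of the means gives `s ≥ 2 * c`, optimality gives `s ≤ 2 * c`. Then `(A - B) ^ 2
  -- ≤ (A + B) ^ 2 - 4 * c * c` tends to 0.
  have hsq0 : s * s - 4 * (c * c) = 0 := by
    refine le_antisymm (by nlinarith) (ge_of_tendsto' hsq fun n => ?_)
    linarith [hAB n, mul_self_nonneg (A n - B n)]
  have hs2 : s = 2 * c := by nlinarith
  rw [hsq0] at hsq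
  have hdiff : Tendsto (fun n => (A n - B n) ^ 2) atTop (𝓝 0) :=
    squeeze_zero (fun n => sq_nonneg _) (fun n => by linarith [hAB n]) hsq
  have hdiff0 : Tendsto (fun n => A n - B n) atTop (𝓝 0) := by
    have h1 := hdiff.sqrt
    simp only [Real.sqrt_sq_eq_abs, Real.sqrt_zero] at h1
    exact (tendsto_zero_iff_abs_tendsto_zero _).2 h1
  have hAlim : Tendsto A atTop (𝓝 c) := by
    have := (hsum.add hdiff0).div_const 2
    rw [hs2, add_zero, mul_div_cancel_left₀ _ two_ne_zero] at this
    exact this.congr fun n => by ring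
  have hBlim : Tendsto B atTop (𝓝 c) := by
    have := hsum.sub hAlim
    rw [hs2] at this
    convert this using 1
    · ext n; ring
    · congr 1; ring
  constructor
  · have h1 := ((hAlim.div_const p).sub_const 1).div_const (G - 1)
    have h2 := (tendsto_const_nhds (x := (1 : ℝ))).sub h1
    have e : (c / p - 1) / (G - 1) = e₁ := by rw [hc]; field_simp; ring
    rw [e] at h2
    refine h2.congr fun n => ?_
    simp only [hA]
    field_simp
    ring
  · have h1 := ((hBlim.div_const (1 - p)).sub_const 1).div_const (G - 1)
    have e : (c / (1 - p) - 1) / (G - 1) = e₂ := by rw [hbal]; field_simp; ring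
    rw [e] at h1
    refine h1.congr fun n => ?_
    simp only [hB]
    field_simp
    ring

theorem tendsto_div_one_of_defect {N v Θ d : ℕ → ℝ} {d₀ : ℝ} (hd₀ : 0 < d₀)
    (hΘ : Tendsto Θ atTop (𝓝 1)) (hd : Tendsto d atTop (𝓝 d₀)) (hv : ∀ᶠ n in atTop, 0 < v n)
    (hN : ∀ n, N n ≤ v n) (h : ∀ᶠ n in atTop, d n * (v n - N n) ≤ (1 - Θ n) * v n) :
    Tendsto (fun n => N n / v n) atTop (𝓝 1) := by
  have h1 : Tendsto (fun n => 1 - (1 - Θ n) / d n) atTop (𝓝 1) := by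
    have := (tendsto_const_nhds (x := (1 : ℝ))).sub
      (((tendsto_const_nhds (x := (1 : ℝ))).sub hΘ).div hd hd₀.ne')
    simpa using this
  refine tendsto_of_tendsto_of_tendsto_of_le_of_le' h1 tendsto_const_nhds ?_ ?_
  · filter_upwards [hv, h, hd.eventually_const_lt hd₀] with n h2 h3 h4
    rw [le_div_iff₀ h2, sub_mul, one_mul, div_mul_eq_mul_div]
    have : v n - N n ≤ (1 - Θ n) * v n / d n := by
      rw [le_div_iff₀ h4]
      linarith
    linarith
  · filter_upwards [hv] with n h2
    exact (div_le_one h2).2 (hN n)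

namespace Protocol

variable {S : Type*} {m : ℕ} [Fintype S] {E : Environment S} {Q : Protocol S m} {x y : Fin m}

theorem AbsorbsAt.condLastStep_eq (h : Q.AbsorbsAt E x y) (θ : Nature) (i : Fin m) (A : Set S)
    [DecidablePred (· ∈ A)] (j : Fin m) : Q.condLastStep E θ i A j =
      (∑ s with s ∈ A, Q.weight E θ i s * Q.f i s j) / Q.visits E θ j := by
  simp only [condLastStep, h.absorbFromProb_eq, absorbProb, visits, weight]
  congr!

theorem AbsorbsAt.sum_last_step_le (h : Q.AbsorbsAt E x y) (θ : Nature) (i : Fin m) (A : Set S)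
    [DecidablePred (· ∈ A)] (j : Fin m) :
    ∑ s with s ∈ A, Q.weight E θ i s * Q.f i s j ≤ Q.visits E θ j := by
  have h0 : ∀ i s, 0 ≤ Q.weight E θ i s * Q.f i s j := fun i s =>
    mul_nonneg (AbsorbsAt.weight_nonneg Q E θ i s) (Q.f_nonneg i s j)
  calc ∑ s with s ∈ A, Q.weight E θ i s * Q.f i s j
      ≤ ∑ s, Q.weight E θ i s * Q.f i s j :=
        Finset.sum_le_sum_of_subset_of_nonneg (Finset.filter_subset _ _) fun s _ _ => h0 i s
    _ ≤ ∑ i, ∑ s, Q.weight E θ i s * Q.f i s j :=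
        Finset.single_le_sum (f := fun i => ∑ s, Q.weight E θ i s * Q.f i s j)
          (fun i _ => Finset.sum_nonneg fun s _ => h0 i s) (Finset.mem_univ i)
    _ ≤ Q.visits E θ j := by
        rw [h.visits_eq_weight]
        exact le_add_of_nonneg_left (Q.g_nonneg j)

end Protocol

end

/-! ### The limit along an asymptotically optimal sequence -/

open Protocol

theorem mainTheorem4 {S : Type*} [Fintype S] (E : Environment S) (m : ℕ) (hm : 4 ≤ m)
    (hγ : E.kappa < E.gamma ^ (m - 2))
    (Q : ℕ → Protocol S m) (hQ : ∀ n, (Q n).IsParsimonious E)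
    (lab : ℕ → ℕ → Fin m) (hlab : ∀ n, (Q n).IsLabeling E (lab n))
    (hopt : Tendsto (fun n => (Q n).receiverValue E) atTop
      (𝓝 (⨆ R : Protocol S m, R.receiverValue E))) :
    (∀ θ : Nature,
      Tendsto (fun n => (Q n).condLastStep E θ (lab n 2) {s | E.ratio s = E.ratioMin} (lab n 1))
        atTop (𝓝 1) ∧
      Tendsto (fun n => (Q n).condLastStep E θ (lab n (m - 1)) {s | E.ratio s = E.ratioMax}
        (lab n m)) atTop (𝓝 1)) ∧
    (∀ i, 2 ≤ i → i ≤ m - 1 → ∀ s : S,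
      Tendsto (fun n => (Q n).f (lab n i) s (lab n 1) + (Q n).f (lab n i) s (lab n m))
        atTop (𝓝 0)) := by
  classical
  have hO : ∀ n, (Q n).IsOrdered E (lab n) := fun n => (hlab n).isOrdered (hQ n)
  have hp := E.prior_pos
  have hp1 := E.prior_lt_one
  have hl := E.ratioMin_pos
  have hL := E.ratioMax_pos
  have hg1 := E.one_lt_gamma
  have hγ0 : 0 < E.gamma := zero_lt_one.trans hg1
  have hG1 : 1 < E.gamma ^ (m - 2) := one_lt_pow₀ hg1 (by omega)
  obtain ⟨e₁, e₂, he₁, he₁1, he₂, he₂1, he, hbal⟩ := exists_optimal_errors hp hp1 hG1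
    ((le_max_left _ _).trans_lt hγ) ((le_max_right _ _).trans_lt hγ)
  set a : ℕ → ℝ := fun n => (Q n).visits E Nature.H (lab n m) with ha
  set b : ℕ → ℝ := fun n => (Q n).visits E Nature.L (lab n m) with hb
  obtain ⟨halim, hblim⟩ : Tendsto a atTop (𝓝 (1 - e₁)) ∧ Tendsto b atTop (𝓝 e₂) := by
    refine tendsto_of_asymptotically_optimal hp hp1 hG1 he₁ he hbal
      (fun n => (hO n).visits_last_le_one _) (fun n => AbsorbsAt.visits_nonneg _ _ _ _)
      (fun n => (hO n).odds_le hm) ?_ (le_iSup_receiverValue E hm he₂ he₂1 he)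
    exact hopt.congr fun n =>
      (hO n).absorbsAt.receiverValue_eq (hO n).action_last (hO n).action_eq_zero
  -- As `G > 1`, the constraint gives `e₁ * e₂ < (1 - e₁) * (1 - e₂)`. So in the limit action H is
  -- strictly likelier under H.
  have hee : e₁ + e₂ < 1 := by
    have := mul_lt_mul_of_pos_right hG1 (mul_pos he₁ he₂)
    linarith
  -- the spread of the odds, relative to the maximal one
  set Θ : ℕ → ℝ := fun n => a n * (1 - b n) / (E.gamma ^ (m - 2) * (b n * (1 - a n))) with hΘ
  have hden : Tendsto (fun n => b n * (1 - a n)) atTop (𝓝 (e₂ * (1 - (1 - e₁)))) :=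
    hblim.mul (tendsto_const_nhds.sub halim)
  have hnum : Tendsto (fun n => a n * (1 - b n)) atTop (𝓝 ((1 - e₁) * (1 - e₂))) :=
    halim.mul (tendsto_const_nhds.sub hblim)
  have hden0 : 0 < e₂ * (1 - (1 - e₁)) := mul_pos he₂ (by linarith)
  have hΘlim : Tendsto Θ atTop (𝓝 1) := by
    have h1 := hnum.div (hden.const_mul (E.gamma ^ (m - 2)))
      (mul_pos (zero_lt_one.trans hG1) hden0).ne'
    rwa [he, show E.gamma ^ (m - 2) * (e₂ * (1 - (1 - e₁))) = E.gamma ^ (m - 2) * (e₁ * e₂) by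
      ring, div_self (mul_pos (zero_lt_one.trans hG1) (mul_pos he₁ he₂)).ne'] at h1
  have hdpos : ∀ᶠ n in atTop, 0 < b n * (1 - a n) := hden.eventually_const_lt hden0
  -- The other alternative of `odds_le_or` loses a factor `γ`, which a spread converging to the
  -- maximum rules out.
  have hgood : ∀ᶠ n in atTop, b n < a n ∧ 0 < (Q n).visitRatio E (lab n 2) := by
    have h1 : E.gamma ^ (m - 3) * (e₂ * (1 - (1 - e₁))) < (1 - e₁) * (1 - e₂) := by
      have h2 : E.gamma ^ (m - 3) < E.gamma ^ (m - 2) := pow_lt_pow_right₀ hg1 (by omega)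
      have := mul_lt_mul_of_pos_right h2 hden0
      linarith
    filter_upwards [(hden.const_mul (E.gamma ^ (m - 3))).eventually_lt hnum h1] with n hn
    exact ((hO n).odds_le_or hm).resolve_left (not_le.2 hn)
  have hΘ1 : ∀ᶠ n in atTop, Θ n ≤ 1 := by
    filter_upwards [hdpos] with n hn
    exact (div_le_one (mul_pos (zero_lt_one.trans hG1) hn)).2 ((hO n).odds_le hm)
  have hΘpos : ∀ᶠ n in atTop, 0 < Θ n := hΘlim.eventually_const_lt one_pos
  -- a uniform gap
  obtain ⟨c₀, hc₀, hc₀1, hgapH, hgapL⟩ := E.exists_ratio_gap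
  -- One gap serves for the signals (`c < c₀`), for adjacent memory states (`1 < (1 - c) * γ`) and,
  -- by the last two conditions, for separating the end likelihood ratios from the ratio 1 of the
  -- initial draw.
  obtain ⟨c, hc, hcc₀, hcγ, hcH, hcL⟩ : ∃ c : ℝ, 0 < c ∧ c < c₀ ∧ 1 < (1 - c) * E.gamma ∧
      e₂ < (1 - c) * (1 - e₁) ∧ e₁ < (1 - c) * (1 - e₂) := by
    have hcont : ∀ d : ℝ, Tendsto (fun c : ℝ => (1 - c) * d) (𝓝[>] 0) (𝓝 d) := by
      intro d
      have : Tendsto (fun c : ℝ => (1 - c) * d) (𝓝 0) (𝓝 ((1 - 0) * d)) :=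
        Continuous.tendsto (by fun_prop) 0
      rw [sub_zero, one_mul] at this
      exact this.mono_left nhdsWithin_le_nhds
    have h1 : ∀ᶠ c : ℝ in 𝓝[>] 0, c < c₀ := nhdsWithin_le_nhds (eventually_lt_nhds hc₀)
    have h2 : ∀ᶠ c : ℝ in 𝓝[>] 0, 0 < c := self_mem_nhdsWithin
    exact (h2.and (h1.and (((hcont _).eventually_const_lt hg1).and
      (((hcont _).eventually_const_lt (by linarith)).and
        ((hcont _).eventually_const_lt (by linarith)))))).exists
  have hc1 : c < 1 := hcc₀.trans hc₀1
  have hnear : ∀ᶠ n in atTop,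
      Θ n * ((Q n).visitRatio E (lab n (m - 1)) * E.ratioMax) * b n ≤ a n ∧
      Θ n * (1 - a n) ≤ (Q n).visitRatio E (lab n 2) * E.ratioMin * (1 - b n) ∧
      ∀ k, 2 ≤ k → k + 1 < m →
        Θ n * E.gamma * (Q n).visitRatio E (lab n k) ≤ (Q n).visitRatio E (lab n (k + 1)) := by
    filter_upwards [hgood, hdpos, hΘpos] with n h1 h2 h3
    refine (hO n).near_equalities hm h1.1 h1.2 h3.le (le_of_eq ?_)
    change Θ n * E.gamma ^ (m - 2) * (b n * (1 - a n)) = a n * (1 - b n)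
    rw [mul_assoc]
    exact div_mul_cancel₀ _ (mul_pos (zero_lt_one.trans hG1) h2).ne'
  have hstep : ∀ᶠ n in atTop, ∀ k, 2 ≤ k → k + 1 < m →
      (Q n).visitRatio E (lab n k) ≤ (1 - c) * (Q n).visitRatio E (lab n (k + 1)) := by
    have h1 : Tendsto (fun n => (1 - c) * (Θ n * E.gamma)) atTop
        (𝓝 ((1 - c) * (1 * E.gamma))) := (hΘlim.mul_const _).const_mul _
    rw [one_mul] at h1
    filter_upwards [hnear, h1.eventually_const_lt hcγ] with n h2 h3 k hk hkm
    have h4 := mul_le_mul_of_nonneg_left (h2.2.2 k hk hkm) (sub_pos.2 hc1).le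
    have h5 := mul_le_mul_of_nonneg_right h3.le
      (AbsorbsAt.visitRatio_nonneg (Q n) E (lab n k))
    linarith
  have hends : ∀ᶠ n in atTop,
      1 ≤ (1 - c) * ((Q n).visitRatio E (lab n (m - 1)) * E.ratioMax) ∧
      (Q n).visitRatio E (lab n 2) * E.ratioMin ≤ 1 - c := by
    filter_upwards [hgood, hblim.eventually_lt (halim.const_mul (1 - c)) hcH,
      (tendsto_const_nhds.sub halim).eventually_lt
        ((tendsto_const_nhds.sub hblim).const_mul (1 - c))
        (show (1 : ℝ) - (1 - e₁) < (1 - c) * (1 - e₂) by linarith)] with n h1 h2 h3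
    obtain ⟨⟨h4, h5⟩, h6, h7⟩ := (hO n).bounds_of_lt (by omega) h1.1 (i₀ := 2)
      (fun i hi him _ => (hO n).mono 2 i le_rfl hi him)
    have hbp := ((hO n).visits_pos hm h1.1 h1.2).1
    have han := (hO n).visits_last_le_one Nature.H
    have hab := h1.1
    change a n ≤ 1 at han
    change 0 < b n at hbp
    change a n ≤ _ * b n at h5
    change _ * (1 - b n) ≤ 1 - a n at h7
    constructor
    · refine le_of_mul_le_mul_right ?_ hbp
      have := mul_le_mul_of_nonneg_left h5 (sub_pos.2 hc1).le
      linarith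
    · refine le_of_mul_le_mul_right (h7.trans h3.le) ?_
      linarith
  have hbpos : ∀ᶠ n in atTop, 0 < b n := hblim.eventually_const_lt he₂
  have hapos : ∀ᶠ n in atTop, 0 < a n := halim.eventually_const_lt (by linarith)
  have ha1 : ∀ᶠ n in atTop, a n < 1 := halim.eventually_lt_const (by linarith)
  have hb1 : ∀ᶠ n in atTop, b n < 1 := hblim.eventually_lt_const he₂1
  have hΘc : Tendsto (fun n => Θ n * c) atTop (𝓝 c) := by simpa using hΘlim.mul_const c
  have hgapH' : ∀ s, s ∉ {s | E.ratio s = E.ratioMax} → E.ratio s ≤ (1 - c) * E.ratioMax := by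
    intro s hs
    refine (hgapH s hs).trans (mul_le_mul_of_nonneg_right (by linarith) hL.le)
  have hgapL' : ∀ s, s ∉ {s | E.ratio s = E.ratioMin} → E.ratioMin ≤ (1 - c) * E.ratio s := by
    intro s hs
    refine (hgapL s hs).trans (mul_le_mul_of_nonneg_right (by linarith) (E.ratio_pos s).le)
  have hhigh := hnear.and (hgood.and (hΘ1.and (hΘpos.and (hstep.and hends))))
  have high : ∀ θ, Tendsto (fun n => (Q n).condLastStep E θ (lab n (m - 1))
      {s | E.ratio s = E.ratioMax} (lab n m)) atTop (𝓝 1) := by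
    have hboth := hhigh.mono fun n ⟨h1, h2, h3, h4, h5, h6⟩ =>
      (hO n).last_step_high hm h2.2 (A := {s | E.ratio s = E.ratioMax}) h4.le h3 hc.le hc1.le h1.1
        hgapH' (by
          have := h5 (m - 2) (by omega) (by omega)
          rwa [show m - 2 + 1 = m - 1 by omega] at this) h6.1
    intro θ
    simp only [(hO _).absorbsAt.condLastStep_eq]
    cases θ with
    | H =>
      exact tendsto_div_one_of_defect hc hΘlim hΘc hapos
        (fun n => (hO n).absorbsAt.sum_last_step_le _ _ _ _) (hboth.mono fun n h => h.2)
    | L =>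
      exact tendsto_div_one_of_defect hc hΘlim tendsto_const_nhds hbpos
        (fun n => (hO n).absorbsAt.sum_last_step_le _ _ _ _) (hboth.mono fun n h => h.1)
  have low : ∀ θ, Tendsto (fun n => (Q n).condLastStep E θ (lab n 2)
      {s | E.ratio s = E.ratioMin} (lab n 1)) atTop (𝓝 1) := by
    have hboth := hhigh.mono fun n ⟨h1, h2, h3, h4, h5, h6⟩ =>
      (hO n).last_step_low h2.2 (A := {s | E.ratio s = E.ratioMin}) h4.le h3 hc.le hc1.le
        (by rw [(hO n).visits_first, (hO n).visits_first]; exact h1.2.1)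
        hgapL' (h5 2 le_rfl (by omega)) h6.2
    intro θ
    simp only [(hO _).absorbsAt.condLastStep_eq]
    cases θ with
    | H =>
      exact tendsto_div_one_of_defect hc hΘlim tendsto_const_nhds
        (ha1.mono fun n h => by rw [(hO n).visits_first]; exact sub_pos.2 h)
        (fun n => (hO n).absorbsAt.sum_last_step_le _ _ _ _) (hboth.mono fun n h => h.1)
    | L =>
      exact tendsto_div_one_of_defect hc hΘlim hΘc
        (hb1.mono fun n h => by rw [(hO n).visits_first]; exact sub_pos.2 h)
        (fun n => (hO n).absorbsAt.sum_last_step_le _ _ _ _) (hboth.mono fun n h => h.2)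
  refine ⟨fun θ => ⟨low θ, high θ⟩, ?_⟩
  -- absorption in either state does not become negligible
  obtain ⟨n₀, hn₀, hn₀1, hn₀2⟩ : ∃ n₀ : ℝ, 0 < n₀ ∧ n₀ < e₂ ∧ n₀ < 1 - e₂ :=
    ⟨min e₂ (1 - e₂) / 2, by have := lt_min he₂ (sub_pos.2 he₂1); linarith,
      by have := lt_min he₂ (sub_pos.2 he₂1); linarith [min_le_left e₂ (1 - e₂)],
      by have := lt_min he₂ (sub_pos.2 he₂1); linarith [min_le_right e₂ (1 - e₂)]⟩
  have hmassH : ∀ᶠ n in atTop, n₀ ≤ ∑ s with s ∈ {s | E.ratio s = E.ratioMax},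
      (Q n).weight E Nature.L (lab n (m - 1)) s * (Q n).f (lab n (m - 1)) s (lab n m) := by
    have h1 := (high Nature.L).mul hblim
    rw [one_mul] at h1
    simp only [(hO _).absorbsAt.condLastStep_eq] at h1
    filter_upwards [h1.eventually_const_lt hn₀1, hbpos] with n h2 h3
    rw [div_mul_cancel₀ _ h3.ne'] at h2
    exact h2.le
  have hmassL : ∀ᶠ n in atTop, n₀ ≤ ∑ s with s ∈ {s | E.ratio s = E.ratioMin},
      (Q n).weight E Nature.L (lab n 2) s * (Q n).f (lab n 2) s (lab n 1) := by
    have h1 := (low Nature.L).mul ((tendsto_const_nhds (x := (1 : ℝ))).sub hblim)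
    rw [one_mul] at h1
    simp only [(hO _).absorbsAt.condLastStep_eq] at h1
    filter_upwards [h1.eventually_const_lt hn₀2, hb1] with n h2 h3
    rw [(hO n).visits_first, div_mul_cancel₀ _ (sub_pos.2 h3).ne'] at h2
    exact h2.le
  intro i hi him s
  set D := (E.ratioMax - E.ratioMin) * n₀ with hD
  have hD0 : 0 < D := mul_pos (sub_pos.2 E.ratioMin_lt_ratioMax) hn₀
  have hΘ4 : ∀ᶠ n in atTop, 1 - Θ n < c / 4 := by
    have h1 := (tendsto_const_nhds (x := (1 : ℝ))).sub hΘlim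
    rw [sub_self] at h1
    exact h1.eventually_lt_const (by linarith)
  have hvis : ∀ᶠ n in atTop,
      D ≤ 2 * E.ratioMax * (1 - Θ n) * (Q n).innerVisits E Nature.L (lab n i) := by
    filter_upwards [hhigh, hmassH, hmassL, hΘ4] with n ⟨h1, h2, h3, h4, h5, h6⟩ h7 h8 h9
    have hcut : ∀ k, 2 ≤ k → k + 1 < m → _ := fun k hk hkm =>
      (hO n).le_innerVisits_of_cut hk hkm h2.2 hc hc1.le h9.le h3 (h1.2.2 k hk hkm)
        (fun j hj hjk => ((hO n).mono j (k - 1) hj (by omega) (by omega)).trans (by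
          have := h5 (k - 1) (by omega) (by omega)
          rwa [show k - 1 + 1 = k by omega] at this))
        (fun j hj hjm => (h5 (k + 1) (by omega) (by omega)).trans
          (mul_le_mul_of_nonneg_left ((hO n).mono (k + 1 + 1) j (by omega) (by omega) hjm)
            (sub_pos.2 hc1).le))
        (A := {s | E.ratio s = E.ratioMin}) (B := {s | E.ratio s = E.ratioMax})
        (fun _ hs => hs) (fun _ hs => hs) h8 h7
    -- Label `i` is the lower side of the cut above it, except for `i = m - 1`, which is the upper
    -- side of the cut below it. That cut exists because `m ≥ 4`.
    by_cases hi' : i + 1 < m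
    · exact (hcut i hi hi').1
    · have := (hcut (i - 1) (by omega) (by omega)).2
      rwa [show i - 1 + 1 = i by omega] at this
  have hsig := E.sig_pos Nature.L s
  have hbound : ∀ᶠ n in atTop, (Q n).f (lab n i) s (lab n 1) + (Q n).f (lab n i) s (lab n m) ≤
      2 * E.ratioMax * (1 - Θ n) / (D * E.sig Nature.L s) := by
    filter_upwards [hvis, hΘ1] with n h1 h2
    have h3 := (hO n).absorbsAt.innerVisits_mul_exit_le Nature.L (lab n i) s
    have hf0 := add_nonneg ((Q n).f_nonneg (lab n i) s (lab n 1))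
      ((Q n).f_nonneg (lab n i) s (lab n m))
    set t := (Q n).f (lab n i) s (lab n 1) + (Q n).f (lab n i) s (lab n m)
    rw [le_div_iff₀ (mul_pos hD0 hsig)]
    have h4 := mul_le_mul_of_nonneg_right h1 (mul_nonneg hsig.le hf0)
    have h5 := mul_le_mul_of_nonneg_left h3
      (mul_nonneg (mul_nonneg zero_le_two hL.le) (sub_nonneg.2 h2))
    unfold weight at h5
    linarith
  refine tendsto_of_tendsto_of_tendsto_of_le_of_le' tendsto_const_nhds ?_
    (Eventually.of_forall fun n => add_nonneg ((Q n).f_nonneg (lab n i) s (lab n 1))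
      ((Q n).f_nonneg (lab n i) s (lab n m))) hbound
  have h1 := (((tendsto_const_nhds (x := (1 : ℝ))).sub hΘlim).const_mul
    (2 * E.ratioMax)).div_const (D * E.sig Nature.L s)
  simpa using h1
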